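/- Time is discrete, $t\in\{0,1,2,\dots\}$. Let $E,E'$ be finite sets. A Markov additive process with kernel $F=(F_{ij}(dx))_{i,j\in E}$ is a process $(J_t,M(t))$, $J_t\in E$, $M(0)=0$, such that, conditionally on $(J_s,M(s))_{s\le t}$, the pair $(J_{t+1},M(t+1)-M(t))$ has law $F_{J_t j}(dx)$; here the $F_{ij}$ are finite measures on $\mathbb R$ with $\sum_jF_{ij}(\mathbb R)=1$, and the transition matrix $(F_{ij}(\mathbb R))_{i,j}$ is assumed irreducible. For $\theta$ with all $\int e^{\theta x}F_{ij}(dx)$ finite, let $e^{\kappa(\theta)}$ be the Perron–Frobenius eigenvalue (the eigenvalue of maximal absolute value) of the matrix $\widehat F[\theta]=\big(\int e^{\theta x}F_{ij}(dx)\big)_{i,j}$ and let $h(\theta)=(h_i(\theta))_i$ be a corresponding positive right eigenvector. Let $A(t)$ (arrivals, with state process $J^A_t\in E$ and nonnegative increments) and $S(t)$ (capacity, with state process $J^S_t\in E'$) be independent Markov additive processes with arbitrary initial distributions. Write $\kappa^A,h^A$ for the quantities above belonging to $A$, and $\kappa^{-S},h^{-S}$ for those belonging to $-S$ (with state process $J^{-S}=J^S$),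 and let $\Theta$ be the interior of the set of $\theta$ for which both $\widehat F^A[\theta]$ and $\widehat F^{-S}[\theta]$ are finite. Write $A(s,t)=A(t)-A(s)$ and $S(s,t)=S(t)-S(s)$. The delay and backlog events are understood in their time-reversed form: for an integer $d\ge0$ and a real $b\ge 0$, $$\{D>d\}=\Big\{\sup_{t\ge d}\big(A(d,t)-S(0,t)\big)>0\Big\},\qquad \{D(t)>d;\,t\le T\}=\{\exists\, t,\ d\le t\le T:\ A(d,t)-S(0,t)>0\},$$ $$\{B>b\}=\Big\{\sup_{t\ge 0}\big(A(t)-S(t)\big)>b\Big\},\qquad \{B(t)>b;\,t\le T\}=\{\exists\, t,\ 0\le t\le T:\ A(t)-S(t)>b\}.$$ For the delay, $\mathbb P_{\boldsymbol i}$ denotes the conditional probability given $J^A_d=i^A,\ J^{-S}_0=i^{-S}$; for the backlog, given $J^A_0=i^A,\ J^{-S}_0=i^{-S}$. Let $\gamma>0$, $\gamma\in\Theta$, satisfy $\kappa^A(\gamma)+\kappa^{-S}(\gamma)=0$ and $\dot\kappa^A(\gamma)+\dot\kappa^{-S}(\gamma)>0$. **Delay.** Put $y_\gamma=\dfrac{\dot\kappa^A(\gamma)}{\dot\kappa^A(\gamma)+\dot\kappa^{-S}(\gamma)}$.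 Let $y>1$, let $\theta\in\Theta$ be a root of $y\,\dot\kappa^{-S}(\theta)=-(y-1)\,\dot\kappa^A(\theta)$, and put $\theta_y=-y\,\kappa^{-S}(\theta)-(y-1)\,\kappa^A(\theta)$. Then for every integer $d\ge 0$ and all $i^A\in E$, $i^{-S}\in E'$, $$\mathbb P_{\boldsymbol i}(D(t)>d;\,t\le yd)\le H^D_+\,h^{-S}_{i^{-S}}(\theta)\,e^{-d\theta_y}\quad\text{if } y<y_\gamma,$$ $$\mathbb P_{\boldsymbol i}(D>d)-\mathbb P_{\boldsymbol i}(D(t)>d;\,t\le yd)\le H^D_+\,h^{-S}_{i^{-S}}(\theta)\,e^{-d\theta_y}\quad\text{if } y>y_\gamma,$$ where $H^D_+=\dfrac{\max_{j\in E}h^A_j(\theta)}{\min_{j\in E}h^A_j(\theta)}\cdot\dfrac1{\min_{j\in E'}h^{-S}_j(\theta)}$. **Backlog.** Put $y_\gamma=\dfrac{1}{\dot\kappa^A(\gamma)+\dot\kappa^{-S}(\gamma)}$. Let $y>0$, let $\theta\in\Theta$ be a root of $y\big(\dot\kappa^A(\theta)+\dot\kappa^{-S}(\theta)\big)=1$,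 and put $\theta_y=\theta-y\big(\kappa^A(\theta)+\kappa^{-S}(\theta)\big)$. Then for every real $b\ge0$ and all $i^A\in E$, $i^{-S}\in E'$, $$\mathbb P_{\boldsymbol i}(B(t)>b;\,t\le yb)\le H^B_+\,h^A_{i^A}(\theta)\,h^{-S}_{i^{-S}}(\theta)\,e^{-b\theta_y}\quad\text{if } y<y_\gamma,$$ $$\mathbb P_{\boldsymbol i}(B>b)-\mathbb P_{\boldsymbol i}(B(t)>b;\,t\le yb)\le H^B_+\,h^A_{i^A}(\theta)\,h^{-S}_{i^{-S}}(\theta)\,e^{-b\theta_y}\quad\text{if } y>y_\gamma,$$ where $H^B_+=\dfrac1{\min_{j\in E}h^A_j(\theta)}\cdot\dfrac1{\min_{j\in E'}h^{-S}_j(\theta)}$. -/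

import Mathlib

namespace MarkovAdditive

open MeasureTheory ProbabilityTheory

/-! ### Measure-valued kernels of discrete-time Markov additive processes -/

section Kernel

variable {E : Type*} [Fintype E]

/-- A measure-valued matrix `F i j (dx)` of defective probability distributions on `ℝ` whose rows
have total mass one: `F i j (dx) = P_{i,0}(J_1 = j, Y_1 ∈ dx)`. -/
def IsKernel (F : E → E → Measure ℝ) : Prop :=
  ∀ i, ∑ j, F i j Set.univ = 1

/-- The transition matrix `p i j = P_i(J_1 = j)` of the underlying Markov chain. -/
noncomputable def transitionMatrix (F : E → E → Measure ℝ) : Matrix E E ℝ :=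
  fun i j => (F i j).real Set.univ

/-- The kernel of the process `-S` when `F` is the kernel of `S`. -/
noncomputable def negKernel (F : E → E → Measure ℝ) : E → E → Measure ℝ :=
  fun i j => (F i j).map (fun x => -x)

/-- The set of all `θ` for which every `∫ e^{θ x} F i j (dx)` is finite. -/
def expDomain (F : E → E → Measure ℝ) : Set ℝ :=
  {θ | ∀ i j, Integrable (fun x : ℝ => Real.exp (θ * x)) (F i j)}

/-- The matrix with entries `∫ e^{θ x} F i j (dx)`. -/
noncomputable def expMatrix (F : E → E → Measure ℝ) (θ : ℝ) : Matrix E E ℝ :=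
  fun i j => ∫ x, Real.exp (θ * x) ∂(F i j)

/-- `κ(θ)`: the logarithm of the Perron-Frobenius eigenvalue of `expMatrix F θ`, the maximal
absolute value of its (complex) eigenvalues. -/
noncomputable def kappa [DecidableEq E] (F : E → E → Measure ℝ) (θ : ℝ) : ℝ :=
  Real.log (spectralRadius ℂ ((expMatrix F θ).map (fun x : ℝ => (x : ℂ)))).toReal

/-- `h` is a right Perron-Frobenius eigenvector of `expMatrix F θ`: it is positive and belongs to
the eigenvalue `e^{κ(θ)}`. No normalization is imposed. -/
def IsPerronVector [DecidableEq E] (F : E → E → Measure ℝ) (θ : ℝ) (h : E → ℝ) : Prop :=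
  (∀ i, 0 < h i) ∧ (expMatrix F θ).mulVec h = Real.exp (kappa F θ) • h

end Kernel

/-! ### Markov additive processes -/

section Additive

variable {Ω E : Type*} [MeasurableSpace Ω] [MeasurableSpace E]

/-- The history `σ((J_0, S(0)), …, (J_t, S(t)))` of the bivariate process up to time `t`. -/
abbrev history (J : ℕ → Ω → E) (S : ℕ → Ω → ℝ) (t : ℕ) : MeasurableSpace Ω :=
  ⨆ s ∈ Set.Iic t, MeasurableSpace.comap (fun ω => (J s ω, S s ω)) inferInstance

/-- `(J, S)` is, under `μ`, a discrete-time Markov additive process with kernel `F`: given the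
history up to time `t`, the next increment of `S` and the next state have the joint law
`F (J_t) j (dx)`. The initial distribution is the law of `J 0`, which is arbitrary. -/
structure IsProcess [Fintype E] (μ : Measure Ω) (F : E → E → Measure ℝ)
    (J : ℕ → Ω → E) (S : ℕ → Ω → ℝ) : Prop where
  measurable_state : ∀ t, Measurable (J t)
  measurable_additive : ∀ t, Measurable (S t)
  start_zero : ∀ ω, S 0 ω = 0
  markov_additive : ∀ (t : ℕ) (f : ℝ → ℝ) (g : E → ℝ), Measurable f → (∃ C, ∀ x, |f x| ≤ C) →
    μ[fun ω => f (S (t + 1) ω - S t ω) * g (J (t + 1) ω) | history J S t] =ᵐ[μ]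
      fun ω => ∑ j, g j * ∫ x, f x ∂(F (J t ω) j)

end Additive

/-! ### The queue -/

section Queue

/-- `X(s,t) = X(t) - X(s)`, the cumulative amount of `X` in the time interval `(s,t]`. -/
def cumul (X : ℕ → ℝ) (s t : ℕ) : ℝ := X t - X s

/-- The backlog `B(t) = sup_{0 ≤ s ≤ t} (A(s,t) - S(s,t))`. -/
noncomputable def backlog (A S : ℕ → ℝ) (t : ℕ) : ℝ :=
  (Finset.range (t + 1)).sup' Finset.nonempty_range_add_one fun s => cumul A s t - cumul S s t

/-- The output `A*(t) = A(t) - B(t)`. -/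
noncomputable def output (A S : ℕ → ℝ) (t : ℕ) : ℝ := cumul A 0 t - backlog A S t

/-- The virtual delay `D(t) = inf {d ≥ 0 : A(t-d) ≤ A*(t)}`, where `A` vanishes before time `0`. -/
noncomputable def delay (A S : ℕ → ℝ) (t : ℕ) : ℕ :=
  sInf {d : ℕ | cumul A 0 (t - d) ≤ output A S t}

/-- The path whose increments over `(0,T]` are those of `X` in reversed order. -/
def reverse (X : ℕ → ℝ) (T : ℕ) : ℕ → ℝ := fun s => X T - X (T - s)

variable {Ω : Type*}

/-- The event `D > d` in its time-reversed form `sup_{t ≥ d} (A(d,t) - S(0,t)) > 0`. -/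
def delayExceeds (A S : ℕ → Ω → ℝ) (d : ℕ) : Set Ω :=
  {ω | ∃ t : ℕ, d ≤ t ∧ 0 < cumul (A · ω) d t - cumul (S · ω) 0 t}

/-- The event `D(t) > d; t ≤ T` in its time-reversed form: the first time `t ≥ d` with
`A(d,t) - S(0,t) > 0` is at most `T`. -/
def delayExceedsBy (A S : ℕ → Ω → ℝ) (d : ℕ) (T : ℝ) : Set Ω :=
  {ω | ∃ t : ℕ, d ≤ t ∧ (t : ℝ) ≤ T ∧ 0 < cumul (A · ω) d t - cumul (S · ω) 0 t}

/-- The event `B > b` in its time-reversed form `sup_{t ≥ 0} (A(t) - S(t)) > b`. -/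
def backlogExceeds (A S : ℕ → Ω → ℝ) (b : ℝ) : Set Ω :=
  {ω | ∃ t : ℕ, b < cumul (A · ω) 0 t - cumul (S · ω) 0 t}

/-- The event `B(t) > b; t ≤ T` in its time-reversed form: the first time `t` with
`A(t) - S(t) > b` is at most `T`. -/
def backlogExceedsBy (A S : ℕ → Ω → ℝ) (b : ℝ) (T : ℝ) : Set Ω :=
  {ω | ∃ t : ℕ, (t : ℝ) ≤ T ∧ b < cumul (A · ω) 0 t - cumul (S · ω) 0 t}

/-- Pathwise time reversal for the backlog: the queue fed with the reversed increments has
`B(T) > b` exactly if `A(t) - S(t) > b` for some `t ≤ T`. -/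
theorem lt_backlog_reverse_iff (A S : ℕ → ℝ) (T : ℕ) (b : ℝ) :
    b < backlog (reverse A T) (reverse S T) T ↔
      ∃ t ≤ T, b < cumul A 0 t - cumul S 0 t := by
  unfold backlog
  rw [Finset.lt_sup'_iff]
  constructor
  · rintro ⟨s, hs, h⟩
    refine ⟨T - s, Nat.sub_le _ _, ?_⟩
    simp only [cumul, reverse, Nat.sub_self] at h ⊢
    linarith
  · rintro ⟨t, ht, h⟩
    refine ⟨T - t, Finset.mem_range.2 (by omega), ?_⟩
    simp only [cumul, reverse, Nat.sub_self, Nat.sub_sub_self ht] at h ⊢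
    linarith

/-- Pathwise time reversal for the delay: for nondecreasing cumulative arrivals and capacity, the
queue fed with the reversed increments has `D(T) > d` exactly if `A(d,t) - S(0,t) > 0` for some
`t` with `d ≤ t ≤ T`. -/
theorem lt_delay_reverse_iff (A S : ℕ → ℝ) (hA : Monotone A) (hS : Monotone S) (T d : ℕ) :
    d < delay (reverse A T) (reverse S T) T ↔
      ∃ t, d ≤ t ∧ t ≤ T ∧ 0 < cumul A d t - cumul S 0 t := by
  have key : ∀ e : ℕ, ¬ (cumul (reverse A T) 0 (T - e) ≤ output (reverse A T) (reverse S T) T) ↔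
      ∃ t, e ≤ t ∧ t ≤ T ∧ 0 < cumul A e t - cumul S 0 t := by
    intro e
    rw [not_le]
    have h1 : output (reverse A T) (reverse S T) T < cumul (reverse A T) 0 (T - e) ↔
        A (min e T) - A 0 < backlog (reverse A T) (reverse S T) T := by
      have h2 : T - (T - e) = min e T := by omega
      simp only [output, cumul, reverse, Nat.sub_self, Nat.sub_zero, h2]
      constructor <;> intro h <;> linarith
    rw [h1, lt_backlog_reverse_iff]
    constructor
    · rintro ⟨t, ht, h⟩
      have h3 : S 0 ≤ S t := hS (Nat.zero_le t)
      simp only [cumul] at h ⊢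
      have h4 : min e T < t := by
        by_contra hc
        have := hA (not_lt.1 hc)
        linarith
      have h5 : min e T = e := by omega
      rw [h5] at h h4
      exact ⟨t, h4.le, ht, by linarith⟩
    · rintro ⟨t, het, ht, h⟩
      refine ⟨t, ht, ?_⟩
      have h5 : min e T = e := by omega
      simp only [cumul] at h ⊢
      rw [h5]
      linarith
  rw [← key d]
  unfold delay
  set D : Set ℕ :=
    {e : ℕ | cumul (reverse A T) 0 (T - e) ≤ output (reverse A T) (reverse S T) T} with hD
  have hne : D.Nonempty := by
    refine ⟨T + 1, ?_⟩
    by_contra hc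
    obtain ⟨t, h1, h2, -⟩ := (key (T + 1)).1 hc
    omega
  have hmono : ∀ e ∈ D, ∀ e', e ≤ e' → e' ∈ D := by
    intro e he e' hee
    by_contra hc
    obtain ⟨t, h1, h2, h3⟩ := (key e').1 hc
    refine (key e).2 ⟨t, hee.trans h1, h2, ?_⟩ he
    have := hA hee
    simp only [cumul] at h3 ⊢
    linarith
  constructor
  · intro h hd
    exact absurd (Nat.sInf_le (s := D) hd) (not_le.2 h)
  · intro h
    by_contra hc
    exact h (hmono _ (Nat.sInf_mem hne) d (not_lt.1 hc))

end Queue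

/-! ### Constants -/

/-- `H_+^D = (max h^A / min h^A) (1 / min h^{-S})`. -/
noncomputable def delayConst {E E' : Type*} (hA : E → ℝ) (hS : E' → ℝ) : ℝ :=
  (⨆ j, hA j) / (⨅ j, hA j) * (1 / ⨅ j, hS j)

/-- `H_+^B = (1 / min h^A) (1 / min h^{-S})`. -/
noncomputable def backlogConst {E E' : Type*} (hA : E → ℝ) (hS : E' → ℝ) : ℝ :=
  1 / (⨅ j, hA j) * (1 / ⨅ j, hS j)

end MarkovAdditive

open MeasureTheory ProbabilityTheory MarkovAdditive

/-!
If `h` is a Perron vector of `expMatrix F θ`, then `exp (θ X(d,t) - (t - d) κ(θ)) h(J_t)` is a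
nonnegative martingale in `t ≥ d`. The product of the martingales of the independent processes `A`
(started at `d`) and `-S` (started at `0`) is again a martingale, and when `A(d,t) - S(0,t)`
exceeds `b` it is at least `min h^A · min h^{-S} · exp (θ b + d κ^A - t (κ^A + κ^{-S}))`. Ville's
maximal inequality, conditionally on the initial states, bounds the probability of such an
exceedance. If `κ^A + κ^{-S} ≥ 0` at `θ`, the exponent is smallest at the latest time, which gives
the bounds up to the deadline; if it is `≤ 0`, at the earliest time, which gives those beyond it.

The function `k = κ^A + κ^{-S}` is convex and differentiable, and `θ` is a stationary point of the
convex function `y k - u`, where `u = κ^A` for the delay and `u(t) = t` for the backlog. Since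
`y_γ = u'(γ) / k'(γ)`, comparing the slopes at `γ` and `θ` shows `γ < θ` if `y < y_γ` and `θ < γ`
if `y > y_γ`, and hence gives the sign of `k(θ)`. Convexity of `κ` is Kingman's theorem; its
differentiability follows by enclosing `e^κ` between the Collatz–Wielandt quotients of a Perron
vector corrected to first order.
-/

namespace MarkovAdditive

/-! ### Roots of a convex function and stationary points -/

section ConvexRoot

open Filter Topology

variable {s : Set ℝ} {f : ℝ → ℝ} {x y γ : ℝ}

theorem add_deriv_mul_sub_le_of_convexOn (hf : ConvexOn ℝ s f) (hx : x ∈ s) (hy : y ∈ s)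
    (hdx : DifferentiableAt ℝ f x) : f x + deriv f x * (y - x) ≤ f y := by
  rcases lt_trichotomy x y with hxy | rfl | hyx
  · have := hf.le_slope_of_hasDerivAt hx hy hxy hdx.hasDerivAt
    rw [slope_def_field, le_div_iff₀ (sub_pos.2 hxy)] at this
    linarith
  · simp
  · have := hf.slope_le_of_hasDerivAt hy hx hyx hdx.hasDerivAt
    rw [slope_def_field, div_le_iff₀ (sub_pos.2 hyx)] at this
    linarith

theorem lt_of_deriv_lt_of_convexOn (hf : ConvexOn ℝ s f) (hx : x ∈ s) (hy : y ∈ s)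
    (hdx : DifferentiableAt ℝ f x) (hdy : DifferentiableAt ℝ f y)
    (hlt : deriv f x < deriv f y) : x < y := by
  have htangent_x := add_deriv_mul_sub_le_of_convexOn hf hx hy hdx
  have htangent_y := add_deriv_mul_sub_le_of_convexOn hf hy hx hdy
  by_contra! hyx
  rcases hyx.eq_or_lt with rfl | hyx
  · exact lt_irrefl _ hlt
  · nlinarith

theorem nonneg_of_root_lt_of_convexOn (hf : ConvexOn ℝ s f) (hγ : γ ∈ s) (hx : x ∈ s)
    (hroot : f γ = 0) (hderiv : 0 < deriv f γ) (hγx : γ < x) : 0 ≤ f x := by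
  have := add_deriv_mul_sub_le_of_convexOn hf hγ hx
    (differentiableAt_of_deriv_ne_zero hderiv.ne')
  nlinarith

theorem nonpos_of_lt_root_of_convexOn (hf : ConvexOn ℝ s f) (hγ : γ ∈ s) (hx : x ∈ s)
    (hdx : DifferentiableAt ℝ f x) (hroot : f γ = 0) (hxγ : x < γ) (hderiv : 0 ≤ deriv f x) :
    f x ≤ 0 := by
  have := add_deriv_mul_sub_le_of_convexOn hf hx hγ hdx
  nlinarith

theorem exists_neg_of_deriv_pos (hγ : 0 < γ) (hroot : f γ = 0) (hderiv : 0 < deriv f γ) :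
    ∃ z, 0 < z ∧ z < γ ∧ f z < 0 := by
  have hsign : ∀ᶠ t in 𝓝[<] γ, SignType.sign (f t) = SignType.sign (t - γ) :=
    (eventually_nhdsWithin_sign_eq_of_deriv_pos hderiv hroot).filter_mono nhdsWithin_le_nhds
  obtain ⟨z, hz, hz0, hzγ⟩ := (hsign.and (Ioo_mem_nhdsLT hγ)).exists
  exact ⟨z, hz0, hzγ, sign_eq_neg_one_iff.1 (hz.trans (sign_neg (sub_neg.2 hzγ)))⟩

/-- A point `x < 0` with `f' x ≥ 0` would force `f` to be monotone to the right of `x`, but `f` is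
negative somewhere between its roots `0` and `γ`. -/
theorem nonneg_of_deriv_nonneg_of_convexOn (hf : ConvexOn ℝ s f) (hγs : γ ∈ s) (hx : x ∈ s)
    (hdx : DifferentiableAt ℝ f x) (hγ : 0 < γ) (hzero : f 0 = 0) (hroot : f γ = 0)
    (hderivγ : 0 < deriv f γ) (hderiv : 0 ≤ deriv f x) : 0 ≤ x := by
  by_contra! hneg
  obtain ⟨z, hz0, hzγ, hfz⟩ := exists_neg_of_deriv_pos hγ hroot hderivγ
  have hz : z ∈ s := hf.1.ordConnected.out hx hγs ⟨(hneg.trans hz0).le, hzγ.le⟩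
  have htangent := add_deriv_mul_sub_le_of_convexOn hf hx hz hdx
  have hxz : f x ≤ f z := by nlinarith
  have hmax := hf.le_max_of_mem_Icc hx hz ⟨hneg.le, hz0.le⟩
  rw [max_eq_right hxz, hzero] at hmax
  linarith

variable {k u : ℝ → ℝ} {c : ℝ}

theorem deriv_const_smul_sub (hk : DifferentiableAt ℝ k x) (hu : DifferentiableAt ℝ u x) :
    deriv (c • k - u) x = c * deriv k x - deriv u x := by
  rw [deriv_sub (hk.const_smul c) hu, deriv_const_smul c hk, smul_eq_mul]

theorem nonneg_and_nonneg_of_lt_deriv_div_deriv (hk : ConvexOn ℝ s k)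
    (hku : ConvexOn ℝ s (c • k - u)) (hγs : γ ∈ s) (hx : x ∈ s) (hkx : DifferentiableAt ℝ k x)
    (huγ : DifferentiableAt ℝ u γ) (hux : DifferentiableAt ℝ u x) (hγ : 0 < γ) (hroot : k γ = 0)
    (hderivγ : 0 < deriv k γ) (hstat : c * deriv k x = deriv u x)
    (hlt : c < deriv u γ / deriv k γ) : 0 ≤ x ∧ 0 ≤ k x := by
  have hkγ := differentiableAt_of_deriv_ne_zero hderivγ.ne'
  rw [lt_div_iff₀ hderivγ] at hlt
  have hγx : γ < x := by
    refine lt_of_deriv_lt_of_convexOn hku hγs hx ((hkγ.const_smul c).sub huγ)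
      ((hkx.const_smul c).sub hux) ?_
    rw [deriv_const_smul_sub hkγ huγ, deriv_const_smul_sub hkx hux]
    linarith
  exact ⟨(hγ.trans hγx).le, nonneg_of_root_lt_of_convexOn hk hγs hx hroot hderivγ hγx⟩

theorem nonneg_and_nonpos_of_deriv_div_deriv_lt (hk : ConvexOn ℝ s k)
    (hku : ConvexOn ℝ s (c • k - u)) (hγs : γ ∈ s) (hx : x ∈ s) (hkx : DifferentiableAt ℝ k x)
    (huγ : DifferentiableAt ℝ u γ) (hux : DifferentiableAt ℝ u x) (hγ : 0 < γ) (hzero : k 0 = 0)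
    (hroot : k γ = 0) (hderivγ : 0 < deriv k γ) (hc : 0 < c) (hderivx : 0 ≤ deriv u x)
    (hstat : c * deriv k x = deriv u x) (hlt : deriv u γ / deriv k γ < c) : 0 ≤ x ∧ k x ≤ 0 := by
  have hkγ := differentiableAt_of_deriv_ne_zero hderivγ.ne'
  have hderivkx : 0 ≤ deriv k x := nonneg_of_mul_nonneg_right (hstat ▸ hderivx) hc
  rw [div_lt_iff₀ hderivγ] at hlt
  have hxγ : x < γ := by
    refine lt_of_deriv_lt_of_convexOn hku hx hγs ((hkx.const_smul c).sub hux)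
      ((hkγ.const_smul c).sub huγ) ?_
    rw [deriv_const_smul_sub hkγ huγ, deriv_const_smul_sub hkx hux]
    linarith
  exact ⟨nonneg_of_deriv_nonneg_of_convexOn hk hγs hx hkx hγ hzero hroot hderivγ hderivkx,
    nonpos_of_lt_root_of_convexOn hk hγs hx hkx hroot hxγ hderivkx⟩

end ConvexRoot

/-! ### Perron vectors of nonnegative matrices -/

section NonnegativeMatrix

open Matrix

variable {n : Type*} [Fintype n] {M : Matrix n n ℝ}

theorem mulVec_nonneg_of_nonneg (hM : ∀ i j, 0 ≤ M i j) {x : n → ℝ} (hx : 0 ≤ x) :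
    0 ≤ M *ᵥ x :=
  fun i => Finset.sum_nonneg fun j _ => mul_nonneg (hM i j) (hx j)

theorem mulVec_le_mulVec_of_nonneg (hM : ∀ i j, 0 ≤ M i j) {x y : n → ℝ} (hxy : x ≤ y) :
    M *ᵥ x ≤ M *ᵥ y :=
  fun i => Finset.sum_le_sum fun j _ => mul_le_mul_of_nonneg_left (hxy j) (hM i j)

/-- The comparison is made at an index where `y i / x i` is maximal. -/
theorem le_of_mulVec_le_of_le_mulVec (hM : ∀ i j, 0 ≤ M i j) {x y : n → ℝ} {r s : ℝ}
    (hx : ∀ i, 0 < x i) (hy : 0 ≤ y) (hy0 : y ≠ 0) (hsx : M *ᵥ x ≤ s • x) (hry : r • y ≤ M *ᵥ y) :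
    r ≤ s := by
  obtain ⟨k, hk⟩ := Function.ne_iff.1 hy0
  have : Nonempty n := ⟨k⟩
  obtain ⟨i, hi⟩ := Finite.exists_max fun i => y i / x i
  have hle : y ≤ (y i / x i) • x := fun j => (div_le_iff₀ (hx j)).1 (hi j)
  have hpos : 0 < y i / x i := (div_pos ((hy k).lt_of_ne' hk) (hx k)).trans_le (hi k)
  have hyi : 0 < y i := (div_pos_iff_of_pos_right (hx i)).1 hpos
  have key : r * y i ≤ s * y i :=
    calc r * y i ≤ (M *ᵥ y) i := hry i
      _ ≤ (M *ᵥ (y i / x i) • x) i := mulVec_le_mulVec_of_nonneg hM hle i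
      _ = y i / x i * (M *ᵥ x) i := by rw [mulVec_smul]; rfl
      _ ≤ y i / x i * (s * x i) := mul_le_mul_of_nonneg_left (hsx i) hpos.le
      _ = s * y i := by field_simp [(hx i).ne']
  exact le_of_mul_le_mul_right key hyi

theorem mulVec_pos_of_pos {N : Matrix n n ℝ} (hN : ∀ i j, 0 < N i j) {x : n → ℝ} (hx : 0 ≤ x)
    (hx0 : x ≠ 0) (i : n) : 0 < (N *ᵥ x) i := by
  obtain ⟨j, hj⟩ := Function.ne_iff.1 hx0
  exact Finset.sum_pos' (fun l _ => mul_nonneg (hN i l).le (hx l))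
    ⟨j, Finset.mem_univ j, mul_pos (hN i j) ((hx j).lt_of_ne' hj)⟩

theorem exists_nonneg_mulVec_le (M : Matrix n n ℝ) :
    ∃ s : ℝ, 0 ≤ s ∧ ∃ x : n → ℝ, (∀ i, 0 < x i) ∧ M *ᵥ x ≤ s • x := by
  obtain ⟨s, hs⟩ := Finite.exists_le fun i => (M *ᵥ 1) i
  refine ⟨max s 0, le_max_right _ _, 1, fun _ => one_pos, fun i => ?_⟩
  simpa using Or.inl (hs i)

theorem inv_sum_smul_mem_stdSimplex [Nonempty n] {x : n → ℝ} (hx : ∀ i, 0 < x i) :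
    (∑ i, x i)⁻¹ • x ∈ stdSimplex ℝ n := by
  have hsum : 0 < ∑ i, x i := Finset.sum_pos (fun i _ => hx i) Finset.univ_nonempty
  refine ⟨fun i => mul_nonneg (inv_nonneg.2 hsum.le) (hx i).le, ?_⟩
  simp only [Pi.smul_apply, smul_eq_mul, ← Finset.mul_sum]
  exact inv_mul_cancel₀ hsum.ne'

theorem exists_least_mulVec_le [Nonempty n] (hM : ∀ i j, 0 ≤ M i j) :
    ∃ s : ℝ, 0 ≤ s ∧ (∃ x : n → ℝ, 0 ≤ x ∧ x ≠ 0 ∧ M *ᵥ x ≤ s • x) ∧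
      ∀ (r : ℝ) (y : n → ℝ), (∀ i, 0 < y i) → M *ᵥ y ≤ r • y → s ≤ r := by
  obtain ⟨s₀, hs₀, x₀, hx₀, hsx₀⟩ := exists_nonneg_mulVec_le M
  set K : Set (ℝ × (n → ℝ)) :=
    (Set.Icc 0 s₀ ×ˢ stdSimplex ℝ n) ∩ {p | M *ᵥ p.2 ≤ p.1 • p.2}
  have hK : IsCompact K := (isCompact_Icc.prod (isCompact_stdSimplex ℝ n)).inter_right
    (isClosed_le (continuous_const.matrix_mulVec continuous_snd)
      (continuous_fst.smul continuous_snd))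
  have mem_K : ∀ (r : ℝ) (y : n → ℝ), 0 ≤ r → r ≤ s₀ → (∀ i, 0 < y i) → M *ᵥ y ≤ r • y →
      (r, (∑ i, y i)⁻¹ • y) ∈ K := fun r y hr hrs hy hry => by
    refine ⟨⟨⟨hr, hrs⟩, inv_sum_smul_mem_stdSimplex hy⟩, ?_⟩
    rw [Set.mem_ofPred_eq, mulVec_smul, smul_comm r]
    exact smul_le_smul_of_nonneg_left hry (inv_nonneg.2 (Finset.sum_nonneg fun i _ => (hy i).le))
  obtain ⟨⟨s, x⟩, ⟨⟨hs, hx⟩, hsx⟩, hmin⟩ :=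
    hK.exists_isMinOn ⟨_, mem_K s₀ x₀ hs₀ le_rfl hx₀ hsx₀⟩ continuous_fst.continuousOn
  refine ⟨s, hs.1, ⟨x, hx.1, ?_, hsx⟩, fun r y hy hry => ?_⟩
  · rintro rfl
    simpa using hx.2
  · rcases le_total r s₀ with hrs | hsr
    · obtain ⟨i⟩ := ‹Nonempty n›
      have hr : 0 ≤ r := nonneg_of_mul_nonneg_left
        ((mulVec_nonneg_of_nonneg hM (fun i => (hy i).le) i).trans (hry i)) (hy i)
      exact hmin (mem_K r y hr hrs hy hry)
    · exact hs.2.trans hsr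

theorem pow_mulVec_le_pow_smul [DecidableEq n] (hM : ∀ i j, 0 ≤ M i j) {x : n → ℝ} {s : ℝ}
    (hs : 0 ≤ s) (hsx : M *ᵥ x ≤ s • x) (k : ℕ) : (M ^ k) *ᵥ x ≤ s ^ k • x := by
  induction k with
  | zero => simp
  | succ k ih =>
    calc (M ^ (k + 1)) *ᵥ x = M *ᵥ ((M ^ k) *ᵥ x) := by rw [pow_succ', mulVec_mulVec]
      _ ≤ M *ᵥ (s ^ k • x) := mulVec_le_mulVec_of_nonneg hM ih
      _ = s ^ k • M *ᵥ x := mulVec_smul _ _ _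
      _ ≤ s ^ k • s • x := smul_le_smul_of_nonneg_left hsx (pow_nonneg hs k)
      _ = s ^ (k + 1) • x := by rw [smul_smul, pow_succ]

theorem exists_pow_mul_pos_of_isIrreducible_of_mulVec_le (hM : M.IsIrreducible) {x : n → ℝ} {s : ℝ}
    (hs : 0 ≤ s) (hx : 0 ≤ x) (hx0 : x ≠ 0) (hsx : M *ᵥ x ≤ s • x) (i : n) :
    ∃ k ≠ 0, 0 < s ^ k * x i := by
  classical
  obtain ⟨j, hj⟩ := Function.ne_iff.1 hx0
  obtain ⟨k, hk, hpos⟩ := (isIrreducible_iff_exists_pow_pos hM.nonneg).1 hM i j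
  refine ⟨k, hk.ne', ?_⟩
  calc 0 < (M ^ k) i j * x j := mul_pos hpos ((hx j).lt_of_ne' hj)
    _ ≤ ((M ^ k) *ᵥ x) i := Finset.single_le_sum (f := fun l => (M ^ k) i l * x l)
        (fun l _ => mul_nonneg (pow_apply_nonneg hM.nonneg k i l) (hx l)) (Finset.mem_univ j)
    _ ≤ s ^ k * x i := pow_mulVec_le_pow_smul hM.nonneg hs hsx k i

theorem forall_pos_of_isIrreducible_of_mulVec_le (hM : M.IsIrreducible) {x : n → ℝ} {s : ℝ}
    (hs : 0 ≤ s) (hx : 0 ≤ x) (hx0 : x ≠ 0) (hsx : M *ᵥ x ≤ s • x) (i : n) : 0 < x i := by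
  obtain ⟨k, -, hk⟩ := exists_pow_mul_pos_of_isIrreducible_of_mulVec_le hM hs hx hx0 hsx i
  exact pos_of_mul_pos_right hk (pow_nonneg hs k)

theorem exists_sum_pow_pos_of_isIrreducible [DecidableEq n] (hM : M.IsIrreducible) :
    ∃ K : ℕ, ∀ i j, 0 < (∑ l ∈ Finset.range K, M ^ l) i j := by
  choose k _ hpos using (isIrreducible_iff_exists_pow_pos hM.nonneg).1 hM
  obtain ⟨K, hK⟩ := Finite.exists_le fun p : n × n => k p.1 p.2
  refine ⟨K + 1, fun i j => ?_⟩
  rw [Matrix.sum_apply]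
  exact (hpos i j).trans_le (Finset.single_le_sum (f := fun l => (M ^ l) i j)
    (fun l _ => pow_apply_nonneg hM.nonneg l i j)
    (Finset.mem_range.2 (Nat.lt_succ_of_le (hK (i, j)))))

/-- Applying a positive polynomial in `M` makes the slack `s • x - M *ᵥ x` positive everywhere. -/
theorem exists_mulVec_le_of_mulVec_le_of_ne [Nonempty n] (hM : M.IsIrreducible) {x : n → ℝ} {s : ℝ}
    (hx : 0 ≤ x) (hx0 : x ≠ 0) (hsx : M *ᵥ x ≤ s • x) (hne : M *ᵥ x ≠ s • x) :
    ∃ r < s, ∃ y : n → ℝ, (∀ i, 0 < y i) ∧ M *ᵥ y ≤ r • y := by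
  classical
  obtain ⟨K, hN⟩ := exists_sum_pow_pos_of_isIrreducible hM
  set N := ∑ l ∈ Finset.range K, M ^ l
  have hcomm : M * N = N * M := Commute.sum_right _ _ _ fun l _ => (Commute.refl M).pow_right l
  have hy : ∀ i, 0 < (N *ᵥ x) i := mulVec_pos_of_pos hN hx hx0
  have hslack : ∀ i, 0 < (N *ᵥ (s • x - M *ᵥ x)) i :=
    mulVec_pos_of_pos hN (sub_nonneg.2 hsx) (sub_ne_zero.2 hne.symm)
  have hMy : M *ᵥ (N *ᵥ x) = s • N *ᵥ x - N *ᵥ (s • x - M *ᵥ x) := by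
    rw [mulVec_sub, mulVec_smul, mulVec_mulVec, mulVec_mulVec, hcomm, sub_sub_cancel]
  obtain ⟨i, hi⟩ := Finite.exists_max fun i => (M *ᵥ (N *ᵥ x)) i / (N *ᵥ x) i
  refine ⟨_, ?_, N *ᵥ x, hy, fun j => (div_le_iff₀ (hy j)).1 (hi j)⟩
  rw [div_lt_iff₀ (hy i), hMy]
  exact sub_lt_self _ (hslack i)

theorem exists_pos_eigenvector_of_isIrreducible [Nonempty n] (hM : M.IsIrreducible) :
    ∃ r : ℝ, 0 < r ∧ ∃ v : n → ℝ, (∀ i, 0 < v i) ∧ M *ᵥ v = r • v := by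
  obtain ⟨s, hs, ⟨x, hx, hx0, hsx⟩, hmin⟩ := exists_least_mulVec_le hM.nonneg
  have hxpos := forall_pos_of_isIrreducible_of_mulVec_le hM hs hx hx0 hsx
  have heq : M *ᵥ x = s • x := by
    by_contra hne
    obtain ⟨r, hrs, y, hy, hry⟩ := exists_mulVec_le_of_mulVec_le_of_ne hM hx hx0 hsx hne
    exact hrs.not_ge (hmin r y hy hry)
  obtain ⟨k, hk0, hk⟩ := exists_pow_mul_pos_of_isIrreducible_of_mulVec_le hM hs hx hx0 hsx
    (Classical.arbitrary n)
  have hspos : 0 < s := hs.lt_of_ne' fun h => by simp [h, hk0] at hk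
  exact ⟨s, hspos, x, hxpos, heq⟩

/-- Subtracting the largest multiple of `v` that keeps `w - c • v` nonnegative leaves an eigenvector
with a zero entry. -/
theorem exists_eq_smul_of_mulVec_eq_smul [Nonempty n] (hM : M.IsIrreducible) {r : ℝ} (hr : 0 ≤ r)
    {v w : n → ℝ} (hv : ∀ i, 0 < v i) (hMv : M *ᵥ v = r • v) (hMw : M *ᵥ w = r • w) :
    ∃ c : ℝ, w = c • v := by
  obtain ⟨i, hi⟩ := Finite.exists_min fun i => w i / v i
  refine ⟨w i / v i, sub_eq_zero.1 ?_⟩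
  by_contra hne
  have hnonneg : 0 ≤ w - (w i / v i) • v := fun j => sub_nonneg.2 ((le_div_iff₀ (hv j)).1 (hi j))
  have heig : M *ᵥ (w - (w i / v i) • v) = r • (w - (w i / v i) • v) := by
    rw [mulVec_sub, mulVec_smul, hMv, hMw, smul_sub, smul_comm]
  have hpos := forall_pos_of_isIrreducible_of_mulVec_le hM hr hnonneg hne heig.le i
  simp [(hv i).ne'] at hpos

/-- The Perron eigenvalue is algebraically simple: modulo `v`, the operator `M - r` is onto. -/
theorem exists_mulVec_eq_add_smul [Nonempty n] (hM : M.IsIrreducible) {r : ℝ} (hr : 0 ≤ r)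
    {v : n → ℝ} (hv : ∀ i, 0 < v i) (hMv : M *ᵥ v = r • v) (z : n → ℝ) :
    ∃ (w : n → ℝ) (c : ℝ), M *ᵥ w - r • w + c • v = z := by
  obtain ⟨r', -, u, hu, hMu⟩ := exists_pos_eigenvector_of_isIrreducible hM.transpose
  have huv : 0 < u ⬝ᵥ v :=
    Finset.sum_pos (fun i _ => mul_pos (hu i) (hv i)) Finset.univ_nonempty
  have hu_mul : ∀ x, u ⬝ᵥ M *ᵥ x = r' * (u ⬝ᵥ x) := fun x => by
    rw [dotProduct_mulVec, ← mulVec_transpose, hMu, smul_dotProduct, smul_eq_mul]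
  have hr' : r' = r := by
    have := hu_mul v
    rw [hMv, dotProduct_smul, smul_eq_mul] at this
    exact (mul_right_cancel₀ huv.ne' this).symm
  obtain ⟨k⟩ := ‹Nonempty n›
  let T : (n → ℝ) →ₗ[ℝ] (n → ℝ) :=
    M.mulVecLin - r • LinearMap.id + (LinearMap.proj k).smulRight v
  have hT : ∀ x, T x = M *ᵥ x - r • x + x k • v := fun x => rfl
  have hinj : Function.Injective T := by
    refine (injective_iff_map_eq_zero T).2 fun x hx => ?_
    rw [hT] at hx
    have hxk : x k = 0 := by
      have := congrArg (u ⬝ᵥ ·) hx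
      simpa [dotProduct_add, dotProduct_sub, hu_mul, hr', huv.ne'] using this
    rw [hxk, zero_smul, add_zero, sub_eq_zero] at hx
    obtain ⟨c, rfl⟩ := exists_eq_smul_of_mulVec_eq_smul hM hr hv hMv hx
    have hc : c = 0 := by simpa [(hv k).ne'] using hxk
    rw [hc, zero_smul]
  obtain ⟨w, hw⟩ := LinearMap.injective_iff_surjective.1 hinj z
  exact ⟨w, w k, by rw [← hT, hw]⟩

variable [DecidableEq n]

theorem mem_spectrum_iff_exists_mulVec_eq_smul {K : Type*} [Field K] {C : Matrix n n K} {z : K} :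
    z ∈ spectrum K C ↔ ∃ w : n → K, w ≠ 0 ∧ C *ᵥ w = z • w := by
  rw [← Matrix.spectrum_toLin', ← Module.End.hasEigenvalue_iff_mem_spectrum]
  constructor
  · intro h
    obtain ⟨w, hw⟩ := h.exists_hasEigenvector
    exact ⟨w, hw.2, by simpa using hw.apply_eq_smul⟩
  · rintro ⟨w, hw0, hw⟩
    exact Module.End.hasEigenvalue_of_hasEigenvector (x := w)
      ⟨Module.End.mem_eigenspace_iff.2 (by simpa using hw), hw0⟩

theorem norm_le_of_mem_spectrum_of_pos_eigenvector (hM : ∀ i j, 0 ≤ M i j) {r : ℝ} {v : n → ℝ}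
    (hv : ∀ i, 0 < v i) (hMv : M *ᵥ v = r • v) {z : ℂ} (hz : z ∈ spectrum ℂ (M.map ((↑) : ℝ → ℂ))) :
    ‖z‖ ≤ r := by
  obtain ⟨w, hw0, hw⟩ := mem_spectrum_iff_exists_mulVec_eq_smul.1 hz
  have hnorm0 : (fun i => ‖w i‖) ≠ 0 := fun h =>
    hw0 (funext fun i => norm_eq_zero.1 (congrFun h i))
  refine le_of_mulVec_le_of_le_mulVec hM hv (fun i => norm_nonneg (w i)) hnorm0 hMv.le fun i => ?_
  calc ‖z‖ * ‖w i‖ = ‖(M.map ((↑) : ℝ → ℂ) *ᵥ w) i‖ := by rw [hw, Pi.smul_apply, norm_smul]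
    _ ≤ ∑ j, ‖(M i j : ℂ) * w j‖ := norm_sum_le _ _
    _ = (M *ᵥ fun i => ‖w i‖) i := by
        simp [mulVec, dotProduct, abs_of_nonneg (hM _ _)]

theorem spectralRadius_eq_of_pos_eigenvector [Nonempty n] (hM : ∀ i j, 0 ≤ M i j) {r : ℝ}
    (hr : 0 ≤ r) {v : n → ℝ} (hv : ∀ i, 0 < v i) (hMv : M *ᵥ v = r • v) :
    spectralRadius ℂ (M.map ((↑) : ℝ → ℂ)) = ENNReal.ofReal r := by
  have hmem : (r : ℂ) ∈ spectrum ℂ (M.map ((↑) : ℝ → ℂ)) := by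
    refine mem_spectrum_iff_exists_mulVec_eq_smul.2 ⟨fun i => (v i : ℂ), fun h => ?_, ?_⟩
    · exact (hv (Classical.arbitrary n)).ne' (by simpa using congrFun h (Classical.arbitrary n))
    · ext i
      simpa [mulVec, dotProduct] using congrArg ((↑) : ℝ → ℂ) (congrFun hMv i)
  refine le_antisymm (iSup₂_le fun z hz => ?_) ?_
  · rw [← enorm_eq_nnnorm, ← ofReal_norm]
    exact ENNReal.ofReal_le_ofReal (norm_le_of_mem_spectrum_of_pos_eigenvector hM hv hMv hz)
  · calc ENNReal.ofReal r = (‖(r : ℂ)‖₊ : ENNReal) := by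
          rw [← enorm_eq_nnnorm, ← ofReal_norm, Complex.norm_real, Real.norm_of_nonneg hr]
      _ ≤ spectralRadius ℂ (M.map ((↑) : ℝ → ℂ)) := le_iSup₂ (α := ENNReal) (r : ℂ) hmem

end NonnegativeMatrix

/-! ### Differentiability of the Perron root -/

section PerronPerturbation

open Matrix Filter Topology

theorem hasDerivAt_of_finite_squeeze {ι : Type*} [Finite ι] {f : ℝ → ℝ} {q : ι → ℝ → ℝ} {c θ : ℝ}
    (hq : ∀ i, HasDerivAt (q i) c θ) (hqf : ∀ i, q i θ = f θ)
    (hsqueeze : ∀ᶠ t in 𝓝 θ, (∃ i, q i t ≤ f t) ∧ ∃ j, f t ≤ q j t) : HasDerivAt f c θ := by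
  have := Fintype.ofFinite ι
  have hsum : (fun t => ∑ i, ‖q i t - q i θ - (t - θ) • c‖) =o[𝓝 θ] fun t => t - θ :=
    Asymptotics.IsLittleO.fun_sum fun i _ => (hasDerivAt_iff_isLittleO.1 (hq i)).norm_left
  refine hasDerivAt_iff_isLittleO.2 ((Asymptotics.IsBigO.of_bound 1 ?_).trans_isLittleO hsum)
  filter_upwards [hsqueeze] with t ⟨⟨i, hi⟩, j, hj⟩
  have hle : ∀ k, |q k t - f θ - (t - θ) • c| ≤ ∑ i, ‖q i t - q i θ - (t - θ) • c‖ := fun k => by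
    rw [← hqf k]
    exact Finset.single_le_sum (f := fun i => ‖q i t - q i θ - (t - θ) • c‖)
      (fun _ _ => norm_nonneg _) (Finset.mem_univ k)
  rw [one_mul, Real.norm_eq_abs]
  refine le_trans ?_ (le_abs_self _)
  rw [abs_le]
  have hlower := (abs_le.1 (hle i)).1
  have hupper := (abs_le.1 (hle j)).2
  constructor <;> linarith

variable {n : Type*} [Fintype n]

theorem hasDerivAt_collatzWielandt {M : ℝ → Matrix n n ℝ} {M' : Matrix n n ℝ} {x : ℝ → n → ℝ}
    {w : n → ℝ} {r θ : ℝ} (hM : ∀ i j, HasDerivAt (fun t => M t i j) (M' i j) θ)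
    (hx : ∀ i, HasDerivAt (fun t => x t i) (w i) θ) (heig : M θ *ᵥ x θ = r • x θ) {i : n}
    (hxi : x θ i ≠ 0) :
    HasDerivAt (fun t => (M t *ᵥ x t) i / x t i)
      ((M' *ᵥ x θ + M θ *ᵥ w - r • w) i / x θ i) θ := by
  have hMx : HasDerivAt (fun t => (M t *ᵥ x t) i) ((M' *ᵥ x θ + M θ *ᵥ w) i) θ := by
    have := HasDerivAt.fun_sum (u := Finset.univ) fun j _ => (hM i j).mul (hx j)
    rwa [Finset.sum_add_distrib] at this
  refine (hMx.div (hx i) hxi).congr_deriv ?_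
  simp only [heig, Pi.smul_apply, Pi.sub_apply, Pi.add_apply, smul_eq_mul]
  field_simp

variable [Nonempty n]

theorem exists_collatzWielandt_le {M : Matrix n n ℝ} (hM : ∀ i j, 0 ≤ M i j) {r : ℝ} {v x : n → ℝ}
    (hv : ∀ i, 0 < v i) (hMv : M *ᵥ v = r • v) (hx : ∀ i, 0 < x i) :
    ∃ i, (M *ᵥ x) i / x i ≤ r := by
  obtain ⟨i, hi⟩ := Finite.exists_min fun i => (M *ᵥ x) i / x i
  have hx0 : x ≠ 0 := Function.ne_iff.2 ⟨i, (hx i).ne'⟩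
  exact ⟨i, le_of_mulVec_le_of_le_mulVec hM hv (fun j => (hx j).le) hx0 hMv.le
    fun j => (le_div_iff₀ (hx j)).1 (hi j)⟩

theorem exists_le_collatzWielandt {M : Matrix n n ℝ} (hM : ∀ i j, 0 ≤ M i j) {r : ℝ} {v x : n → ℝ}
    (hv : ∀ i, 0 < v i) (hMv : M *ᵥ v = r • v) (hx : ∀ i, 0 < x i) :
    ∃ i, r ≤ (M *ᵥ x) i / x i := by
  obtain ⟨i, hi⟩ := Finite.exists_max fun i => (M *ᵥ x) i / x i
  have hv0 : v ≠ 0 := Function.ne_iff.2 ⟨i, (hv i).ne'⟩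
  exact ⟨i, le_of_mulVec_le_of_le_mulVec hM hx (fun j => (hv j).le) hv0
    (fun j => (div_le_iff₀ (hx j)).1 (hi j)) hMv.ge⟩

theorem eigenvalue_nonneg_of_pos_eigenvector {M : Matrix n n ℝ} (hM : ∀ i j, 0 ≤ M i j) {r : ℝ}
    {v : n → ℝ} (hv : ∀ i, 0 < v i) (hMv : M *ᵥ v = r • v) : 0 ≤ r := by
  obtain ⟨i⟩ := ‹Nonempty n›
  refine nonneg_of_mul_nonneg_left ?_ (hv i)
  exact (mulVec_nonneg_of_nonneg hM (fun i => (hv i).le) i).trans_eq (congrFun hMv i)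

/-- The vector `w` is chosen so that all Collatz–Wielandt quotients of `v + (t - θ) • w` have the
same derivative at `θ`; they enclose the eigenvalue, so it has that derivative, too. -/
theorem differentiableAt_of_pos_eigenvector {M : ℝ → Matrix n n ℝ} {ρ : ℝ → ℝ} {θ : ℝ}
    (hirr : (M θ).IsIrreducible) (hdiff : ∀ i j, DifferentiableAt ℝ (fun t => M t i j) θ)
    (hnonneg : ∀ᶠ t in 𝓝 θ, ∀ i j, 0 ≤ M t i j)
    (heig : ∀ᶠ t in 𝓝 θ, ∃ v : n → ℝ, (∀ i, 0 < v i) ∧ M t *ᵥ v = ρ t • v) :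
    DifferentiableAt ℝ ρ θ := by
  obtain ⟨v, hv, hMv⟩ := heig.self_of_nhds
  have hρ := eigenvalue_nonneg_of_pos_eigenvector hirr.nonneg hv hMv
  set M' : Matrix n n ℝ := Matrix.of fun i j => deriv (fun t => M t i j) θ
  obtain ⟨w, c, hwc⟩ := exists_mulVec_eq_add_smul hirr hρ hv hMv (-(M' *ᵥ v))
  set x : ℝ → n → ℝ := fun t => v + (t - θ) • w
  have hxθ : x θ = v := by simp [x]
  have hx : ∀ i, HasDerivAt (fun t => x t i) (w i) θ := fun i => by
    simpa [x] using (((hasDerivAt_id θ).sub_const θ).mul_const (w i)).const_add (v i)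
  have hquot : ∀ i, HasDerivAt (fun t => (M t *ᵥ x t) i / x t i) (-c) θ := fun i => by
    have heigθ : M θ *ᵥ x θ = ρ θ • x θ := by rw [hxθ, hMv]
    have hxi : x θ i ≠ 0 := by rw [hxθ]; exact (hv i).ne'
    refine (hasDerivAt_collatzWielandt (fun i j => (hdiff i j).hasDerivAt) hx heigθ
      hxi).congr_deriv ?_
    rw [div_eq_iff hxi, hxθ]
    have hrow : M' *ᵥ v + M θ *ᵥ w - ρ θ • w = -c • v := by
      rw [neg_smul]
      linear_combination hwc
    exact congrFun hrow i
  have hxpos : ∀ᶠ t in 𝓝 θ, ∀ i, 0 < x t i := eventually_all.2 fun i =>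
    (hx i).continuousAt.eventually_const_lt (by simpa only [hxθ] using hv i)
  refine (hasDerivAt_of_finite_squeeze hquot (fun i => ?_) ?_).differentiableAt
  · rw [hxθ, hMv, Pi.smul_apply, smul_eq_mul, mul_div_cancel_right₀ _ (hv i).ne']
  · filter_upwards [hnonneg, heig, hxpos] with t ht ⟨u, hu, hMu⟩ hxt
    exact ⟨exists_collatzWielandt_le ht hu hMu hxt, exists_le_collatzWielandt ht hu hMu hxt⟩

end PerronPerturbation

/-! ### Log-convexity of the Perron root -/

section GeometricMean

open Matrix

theorem sum_rpow_mul_rpow_le {ι : Type*} (s : Finset ι) {a b : ℝ} (ha : 0 < a) (hb : 0 < b)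
    (hab : a + b = 1) {f g : ι → ℝ} (hf : ∀ i, 0 ≤ f i) (hg : ∀ i, 0 ≤ g i) :
    ∑ i ∈ s, f i ^ a * g i ^ b ≤ (∑ i ∈ s, f i) ^ a * (∑ i ∈ s, g i) ^ b := by
  have hconj : a⁻¹.HolderConjugate b⁻¹ := Real.HolderConjugate.inv_inv ha hb hab
  simpa [Real.rpow_rpow_inv, hf, hg, ha.ne', hb.ne'] using
    Real.inner_le_Lp_mul_Lq_of_nonneg s hconj (fun i _ => Real.rpow_nonneg (hf i) a)
      (fun i _ => Real.rpow_nonneg (hg i) b)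

theorem mulVec_rpow_mul_rpow_le {n : Type*} [Fintype n] {L M N : Matrix n n ℝ} {a b r s : ℝ}
    (ha : 0 < a) (hb : 0 < b) (hab : a + b = 1)
    (hM : ∀ i j, 0 ≤ M i j) (hN : ∀ i j, 0 ≤ N i j) (hL : ∀ i j, L i j ≤ M i j ^ a * N i j ^ b)
    {v w : n → ℝ} (hv : 0 ≤ v) (hw : 0 ≤ w) (hr : 0 ≤ r) (hs : 0 ≤ s)
    (hMv : M *ᵥ v ≤ r • v) (hNw : N *ᵥ w ≤ s • w) :
    (L *ᵥ fun i => v i ^ a * w i ^ b) ≤ (r ^ a * s ^ b) • fun i => v i ^ a * w i ^ b := by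
  intro i
  calc (L *ᵥ fun i => v i ^ a * w i ^ b) i
      ≤ ∑ j, (M i j * v j) ^ a * (N i j * w j) ^ b := Finset.sum_le_sum fun j _ => by
        rw [Real.mul_rpow (hM i j) (hv j), Real.mul_rpow (hN i j) (hw j), mul_mul_mul_comm]
        exact mul_le_mul_of_nonneg_right (hL i j)
          (mul_nonneg (Real.rpow_nonneg (hv j) a) (Real.rpow_nonneg (hw j) b))
    _ ≤ (M *ᵥ v) i ^ a * (N *ᵥ w) i ^ b := sum_rpow_mul_rpow_le _ ha hb hab
        (fun j => mul_nonneg (hM i j) (hv j)) (fun j => mul_nonneg (hN i j) (hw j))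
    _ ≤ (r * v i) ^ a * (s * w i) ^ b := by
        have hMvi := mulVec_nonneg_of_nonneg hM hv i
        have hNwi := mulVec_nonneg_of_nonneg hN hw i
        exact mul_le_mul (Real.rpow_le_rpow hMvi (hMv i) ha.le)
          (Real.rpow_le_rpow hNwi (hNw i) hb.le) (Real.rpow_nonneg hNwi b)
          (Real.rpow_nonneg (hMvi.trans (hMv i)) a)
    _ = r ^ a * s ^ b * (v i ^ a * w i ^ b) := by
        rw [Real.mul_rpow hr (hv i), Real.mul_rpow hs (hw i), mul_mul_mul_comm]

theorem mgf_add_le_rpow_mul_rpow {Ω : Type*} [MeasurableSpace Ω] {μ : Measure Ω} {X : Ω → ℝ}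
    {a b s t : ℝ} (ha : 0 ≤ a) (hb : 0 ≤ b) (hab : a + b = 1)
    (hs : Integrable (fun ω => Real.exp (s * X ω)) μ)
    (ht : Integrable (fun ω => Real.exp (t * X ω)) μ) :
    mgf X μ (a * s + b * t) ≤ mgf X μ s ^ a * mgf X μ t ^ b := by
  have hexp : ∀ ω, ENNReal.ofReal (Real.exp ((a * s + b * t) * X ω)) =
      ENNReal.ofReal (Real.exp (s * X ω)) ^ a * ENNReal.ofReal (Real.exp (t * X ω)) ^ b := by
    intro ω
    rw [ENNReal.ofReal_rpow_of_pos (Real.exp_pos _), ENNReal.ofReal_rpow_of_pos (Real.exp_pos _),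
      ← ENNReal.ofReal_mul (by positivity), ← Real.exp_mul, ← Real.exp_mul, ← Real.exp_add]
    ring_nf
  have hnonneg : ∀ u, 0 ≤ᵐ[μ] fun ω => Real.exp (u * X ω) :=
    fun u => ae_of_all _ fun ω => (Real.exp_pos _).le
  have hst : a * s + b * t ∈ integrableExpSet X μ := convex_integrableExpSet hs ht ha hb hab
  simp only [mgf]
  rw [← ENNReal.ofReal_le_ofReal_iff (by positivity), ENNReal.ofReal_mul (by positivity),
    ← ENNReal.ofReal_rpow_of_nonneg (by positivity) ha,
    ← ENNReal.ofReal_rpow_of_nonneg (by positivity) hb,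
    ofReal_integral_eq_lintegral_ofReal hst (hnonneg _),
    ofReal_integral_eq_lintegral_ofReal hs (hnonneg _),
    ofReal_integral_eq_lintegral_ofReal ht (hnonneg _)]
  simp only [hexp]
  exact ENNReal.lintegral_mul_norm_pow_le hs.aemeasurable.ennreal_ofReal
    ht.aemeasurable.ennreal_ofReal ha hb hab

end GeometricMean

/-! ### The log Perron root of a Markov additive kernel -/

section Kappa

open Matrix Filter Topology

variable {E : Type*} {F : E → E → Measure ℝ} {θ : ℝ}

theorem transitionMatrix_negKernel (F : E → E → Measure ℝ) :
    transitionMatrix (negKernel F) = transitionMatrix F := by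
  ext i j
  simp [negKernel, transitionMatrix, measureReal_def, Measure.map_apply measurable_neg]

theorem expDomain_eq_iInter_integrableExpSet (F : E → E → Measure ℝ) :
    expDomain F = ⋂ i, ⋂ j, integrableExpSet id (F i j) := by
  ext θ
  simp [expDomain, integrableExpSet]

theorem convex_expDomain (F : E → E → Measure ℝ) : Convex ℝ (expDomain F) := by
  rw [expDomain_eq_iInter_integrableExpSet]
  exact convex_iInter fun i => convex_iInter fun j => convex_integrableExpSet

theorem expMatrix_nonneg (F : E → E → Measure ℝ) (θ : ℝ) (i j : E) : 0 ≤ expMatrix F θ i j :=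
  mgf_nonneg (X := id)

theorem differentiableAt_expMatrix (hθ : θ ∈ interior (expDomain F)) (i j : E) :
    DifferentiableAt ℝ (fun t => expMatrix F t i j) θ :=
  differentiableAt_mgf (X := id) (interior_mono (fun t (ht : t ∈ expDomain F) => ht i j) hθ)

theorem isIrreducible_expMatrix [∀ i j, IsFiniteMeasure (F i j)]
    (hirr : (transitionMatrix F).IsIrreducible) (hθ : θ ∈ expDomain F) :
    (expMatrix F θ).IsIrreducible := by
  have hpos : ∀ i j, 0 < expMatrix F θ i j ↔ 0 < transitionMatrix F i j := fun i j => by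
    by_cases h0 : F i j = 0
    · simp [expMatrix, transitionMatrix, h0]
    · have : NeZero (F i j) := ⟨h0⟩
      exact iff_of_true (mgf_pos' (X := id) h0 (hθ i j)) measureReal_univ_pos
  have hquiver : (expMatrix F θ).toQuiver = (transitionMatrix F).toQuiver :=
    congrArg Quiver.mk (funext₂ fun i j => by simp only [hpos])
  exact ⟨expMatrix_nonneg F θ, hquiver ▸ hirr.connected⟩

variable [Fintype E]

theorem IsKernel.isFiniteMeasure (hF : IsKernel F) (i j : E) : IsFiniteMeasure (F i j) := by
  refine ⟨lt_of_le_of_lt ?_ ENNReal.one_lt_top⟩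
  rw [← hF i]
  exact Finset.single_le_sum (f := fun j => F i j Set.univ) (fun _ _ => zero_le)
    (Finset.mem_univ j)

theorem IsKernel.negKernel (hF : IsKernel F) : IsKernel (negKernel F) := fun i => by
  simpa [MarkovAdditive.negKernel, Measure.map_apply measurable_neg] using hF i

variable [DecidableEq E] [Nonempty E]

theorem exp_kappa_eq_of_pos_eigenvector {r : ℝ} (hr : 0 < r) {v : E → ℝ} (hv : ∀ i, 0 < v i)
    (hMv : expMatrix F θ *ᵥ v = r • v) : Real.exp (kappa F θ) = r := by
  have hradius := spectralRadius_eq_of_pos_eigenvector (expMatrix_nonneg F θ) hr.le hv hMv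
  rw [kappa, hradius, ENNReal.toReal_ofReal hr.le, Real.exp_log hr]

theorem kappa_zero (hF : IsKernel F) : kappa F 0 = 0 := by
  have := hF.isFiniteMeasure
  have hrow : expMatrix F 0 *ᵥ 1 = (1 : ℝ) • (1 : E → ℝ) := funext fun i => by
    have := congrArg ENNReal.toReal (hF i)
    rw [ENNReal.toReal_sum fun j _ => measure_ne_top _ _] at this
    simpa [mulVec, dotProduct, expMatrix, measureReal_def] using this
  simpa using exp_kappa_eq_of_pos_eigenvector one_pos (fun _ => one_pos) hrow

theorem exists_isPerronVector [∀ i j, IsFiniteMeasure (F i j)]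
    (hirr : (transitionMatrix F).IsIrreducible) (hθ : θ ∈ expDomain F) :
    ∃ h, IsPerronVector F θ h := by
  obtain ⟨r, hr, v, hv, hMv⟩ :=
    exists_pos_eigenvector_of_isIrreducible (isIrreducible_expMatrix hirr hθ)
  exact ⟨v, hv, by rw [exp_kappa_eq_of_pos_eigenvector hr hv hMv, hMv]⟩

theorem exp_kappa_le_of_mulVec_le [∀ i j, IsFiniteMeasure (F i j)]
    (hirr : (transitionMatrix F).IsIrreducible) (hθ : θ ∈ expDomain F) {r : ℝ} {x : E → ℝ}
    (hx : ∀ i, 0 < x i) (hrx : expMatrix F θ *ᵥ x ≤ r • x) : Real.exp (kappa F θ) ≤ r := by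
  obtain ⟨v, hv, hMv⟩ := exists_isPerronVector hirr hθ
  have hv0 : v ≠ 0 := Function.ne_iff.2 ⟨Classical.arbitrary E, (hv _).ne'⟩
  exact le_of_mulVec_le_of_le_mulVec (expMatrix_nonneg F θ) hx (fun i => (hv i).le) hv0 hrx hMv.ge

theorem monotoneOn_kappa [∀ i j, IsFiniteMeasure (F i j)]
    (hirr : (transitionMatrix F).IsIrreducible) (hnonneg : ∀ i j, ∀ᵐ x ∂(F i j), 0 ≤ x) :
    MonotoneOn (kappa F) (expDomain F) := by
  intro s hs t ht hst
  obtain ⟨w, hw, hMw⟩ := exists_isPerronVector hirr ht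
  refine Real.exp_le_exp.1 (exp_kappa_le_of_mulVec_le hirr hs hw (le_trans (fun i => ?_) hMw.le))
  refine Finset.sum_le_sum fun j _ => mul_le_mul_of_nonneg_right ?_ (hw j).le
  refine integral_mono_ae (hs i j) (ht i j) ?_
  filter_upwards [hnonneg i j] with x hx
  exact Real.exp_le_exp.2 (mul_le_mul_of_nonneg_right hst hx)

/-- Kingman's argument: the geometric mean `v ^ a * w ^ b` of Perron vectors at `s` and `t` is a
supersolution at `a * s + b * t`. -/
theorem convexOn_kappa [∀ i j, IsFiniteMeasure (F i j)]
    (hirr : (transitionMatrix F).IsIrreducible) : ConvexOn ℝ (expDomain F) (kappa F) := by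
  refine convexOn_iff_forall_pos.2 ⟨convex_expDomain F, fun s hs t ht a b ha hb hab => ?_⟩
  obtain ⟨v, hv, hMv⟩ := exists_isPerronVector hirr hs
  obtain ⟨w, hw, hMw⟩ := exists_isPerronVector hirr ht
  have hentry : ∀ i j,
      expMatrix F (a • s + b • t) i j ≤ expMatrix F s i j ^ a * expMatrix F t i j ^ b := fun i j =>
    mgf_add_le_rpow_mul_rpow (X := id) ha.le hb.le hab (hs i j) (ht i j)
  have hmean := mulVec_rpow_mul_rpow_le ha hb hab (expMatrix_nonneg F s) (expMatrix_nonneg F t)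
    hentry (fun i => (hv i).le) (fun i => (hw i).le) (Real.exp_pos _).le (Real.exp_pos _).le
    hMv.le hMw.le
  have hle := exp_kappa_le_of_mulVec_le hirr (convex_expDomain F hs ht ha.le hb.le hab)
    (fun i => mul_pos (Real.rpow_pos_of_pos (hv i) a) (Real.rpow_pos_of_pos (hw i) b)) hmean
  rw [← Real.exp_mul, ← Real.exp_mul, ← Real.exp_add, Real.exp_le_exp] at hle
  simpa only [smul_eq_mul, mul_comm] using hle

theorem differentiableAt_kappa [∀ i j, IsFiniteMeasure (F i j)]
    (hirr : (transitionMatrix F).IsIrreducible) (hθ : θ ∈ interior (expDomain F)) :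
    DifferentiableAt ℝ (kappa F) θ := by
  have hdom : ∀ᶠ t in 𝓝 θ, t ∈ expDomain F := mem_interior_iff_mem_nhds.1 hθ
  have hexp : DifferentiableAt ℝ (fun t => Real.exp (kappa F t)) θ :=
    differentiableAt_of_pos_eigenvector (isIrreducible_expMatrix hirr (interior_subset hθ))
      (differentiableAt_expMatrix hθ) (.of_forall (expMatrix_nonneg F))
      (hdom.mono fun t ht => exists_isPerronVector hirr ht)
  simpa only [Real.log_exp] using hexp.log (Real.exp_pos _).ne'

end Kappa

/-! ### Nonnegative martingales -/

section NonnegMartingale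

open scoped ENNReal

variable {Ω : Type*}

theorem sup_eq_generateFrom_image2_inter (m₁ m₂ : MeasurableSpace Ω) :
    m₁ ⊔ m₂ = MeasurableSpace.generateFrom
      (Set.image2 (· ∩ ·) {s | MeasurableSet[m₁] s} {t | MeasurableSet[m₂] t}) := by
  refine le_antisymm (sup_le (fun s hs => ?_) fun t ht => ?_)
    (MeasurableSpace.generateFrom_le ?_)
  · exact .basic _ ⟨s, hs, Set.univ, MeasurableSet.univ, Set.inter_univ s⟩
  · exact .basic _ ⟨Set.univ, MeasurableSet.univ, t, ht, Set.univ_inter t⟩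
  · rintro _ ⟨s, hs, t, ht, rfl⟩
    exact MeasurableSet.inter (m := m₁ ⊔ m₂) (le_sup_left (b := m₂) s hs)
      (le_sup_right (a := m₁) t ht)

theorem isPiSystem_image2_inter (m₁ m₂ : MeasurableSpace Ω) :
    IsPiSystem (Set.image2 (· ∩ ·) {s | MeasurableSet[m₁] s} {t | MeasurableSet[m₂] t}) := by
  rintro _ ⟨s, hs, t, ht, rfl⟩ _ ⟨s', hs', t', ht', rfl⟩ -
  exact ⟨s ∩ s', MeasurableSet.inter hs hs', t ∩ t', MeasurableSet.inter ht ht',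
    Set.inter_inter_inter_comm s s' t t'⟩

variable {m m₁ m₂ mΩ : MeasurableSpace Ω} {μ : Measure Ω} {f g : Ω → ℝ≥0∞}

theorem trim_withDensity_apply (hm : m ≤ mΩ) {s : Set Ω} (hs : MeasurableSet[m] s) :
    (μ.withDensity f).trim hm s = ∫⁻ ω in s, f ω ∂μ := by
  rw [trim_measurableSet_eq hm hs, withDensity_apply _ (hm s hs)]

theorem setLIntegral_eq_of_forall_inter (h₁ : m₁ ≤ mΩ) (h₂ : m₂ ≤ mΩ) (hf : ∫⁻ ω, f ω ∂μ ≠ ∞)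
    (hfg : ∀ s t, MeasurableSet[m₁] s → MeasurableSet[m₂] t →
      ∫⁻ ω in s ∩ t, f ω ∂μ = ∫⁻ ω in s ∩ t, g ω ∂μ)
    {s : Set Ω} (hs : MeasurableSet[m₁ ⊔ m₂] s) : ∫⁻ ω in s, f ω ∂μ = ∫⁻ ω in s, g ω ∂μ := by
  have hle : m₁ ⊔ m₂ ≤ mΩ := sup_le h₁ h₂
  have huniv := hfg Set.univ Set.univ MeasurableSet.univ MeasurableSet.univ
  have hfinite : IsFiniteMeasure ((μ.withDensity f).trim hle) := by
    refine ⟨?_⟩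
    rw [trim_withDensity_apply hle MeasurableSet.univ, setLIntegral_univ]
    exact hf.lt_top
  have htrim : (μ.withDensity f).trim hle = (μ.withDensity g).trim hle := by
    refine ext_of_generate_finite _ (sup_eq_generateFrom_image2_inter m₁ m₂)
      (isPiSystem_image2_inter m₁ m₂) ?_ ?_
    · rintro _ ⟨s, hs, t, ht, rfl⟩
      have hst : MeasurableSet[m₁ ⊔ m₂] (s ∩ t) :=
        MeasurableSet.inter (m := m₁ ⊔ m₂) (le_sup_left (b := m₂) s hs)
          (le_sup_right (a := m₁) t ht)
      rw [trim_withDensity_apply hle hst, trim_withDensity_apply hle hst, hfg s t hs ht]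
    · rw [trim_withDensity_apply hle MeasurableSet.univ,
        trim_withDensity_apply hle MeasurableSet.univ, ← Set.inter_self Set.univ, huniv]
  rw [← trim_withDensity_apply hle hs, htrim, trim_withDensity_apply hle hs]

theorem setLIntegral_mul_eq_of_forall_setLIntegral_eq (hm : m ≤ mΩ) (hf : Measurable f)
    (hg : Measurable g)
    (hfg : ∀ s, MeasurableSet[m] s → ∫⁻ ω in s, f ω ∂μ = ∫⁻ ω in s, g ω ∂μ) {w : Ω → ℝ≥0∞}
    (hw : Measurable[m] w) {s : Set Ω} (hs : MeasurableSet[m] s) :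
    ∫⁻ ω in s, w ω * f ω ∂μ = ∫⁻ ω in s, w ω * g ω ∂μ := by
  have htrim : (μ.withDensity f).trim hm = (μ.withDensity g).trim hm := by
    refine @Measure.ext _ m _ _ fun t ht => ?_
    rw [trim_withDensity_apply hm ht, trim_withDensity_apply hm ht, hfg t ht]
  have hdensity {u : Ω → ℝ≥0∞} (hu : Measurable u) :
      ∫⁻ ω in s, w ω * u ω ∂μ = ∫⁻ ω in s, w ω ∂(μ.withDensity u).trim hm := by
    rw [restrict_trim hm _ hs, lintegral_trim hm hw,
      setLIntegral_withDensity_eq_setLIntegral_mul _ hu (hw.mono hm le_rfl) (hm s hs)]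
    simp only [Pi.mul_apply, mul_comm]
  rw [hdensity hf, hdensity hg, htrim]

theorem setLIntegral_inter_mul_of_indep (h₁ : m₁ ≤ mΩ) (h₂ : m₂ ≤ mΩ) (hind : Indep m₁ m₂ μ)
    (hf : Measurable[m₁] f) (hg : Measurable[m₂] g) {s t : Set Ω} (hs : MeasurableSet[m₁] s)
    (ht : MeasurableSet[m₂] t) :
    ∫⁻ ω in s ∩ t, f ω * g ω ∂μ = (∫⁻ ω in s, f ω ∂μ) * ∫⁻ ω in t, g ω ∂μ := by
  rw [← lintegral_indicator ((h₁ s hs).inter (h₂ t ht)), ← lintegral_indicator (h₁ s hs),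
    ← lintegral_indicator (h₂ t ht),
    ← lintegral_mul_eq_lintegral_mul_lintegral_of_independent_measurableSpace h₁ h₂ hind
      (hf.indicator hs) (hg.indicator ht)]
  exact lintegral_congr fun ω => Set.inter_indicator_mul f g ω

/-- `X` is, from time `d` on, a martingale with values in `[0, ∞]`. Such a process has no Bochner
conditional expectations in general, so the martingale property is expressed by integrals over the
events of the past. Nothing is required of `X n` for `n < d`. -/
structure IsNonnegMartingaleFrom (μ : Measure Ω) (𝒢 : Filtration ℕ mΩ) (d : ℕ)
    (X : ℕ → Ω → ℝ≥0∞) : Prop where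
  measurable : ∀ n, d ≤ n → Measurable[𝒢 n] (X n)
  setLIntegral_succ : ∀ n, d ≤ n → ∀ s, MeasurableSet[𝒢 n] s →
    ∫⁻ ω in s, X (n + 1) ω ∂μ = ∫⁻ ω in s, X n ω ∂μ

namespace IsNonnegMartingaleFrom

variable {𝒢 𝒦 : Filtration ℕ mΩ} {d : ℕ} {X Y : ℕ → Ω → ℝ≥0∞}

theorem of_le {d' : ℕ} (hX : IsNonnegMartingaleFrom μ 𝒢 d' X) (hd : d' ≤ d) :
    IsNonnegMartingaleFrom μ 𝒢 d X where
  measurable n hn := hX.measurable n (hd.trans hn)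
  setLIntegral_succ n hn := hX.setLIntegral_succ n (hd.trans hn)

theorem setLIntegral_eq (hX : IsNonnegMartingaleFrom μ 𝒢 d X) {m n : ℕ} (hdm : d ≤ m)
    (hmn : m ≤ n) {s : Set Ω} (hs : MeasurableSet[𝒢 m] s) :
    ∫⁻ ω in s, X n ω ∂μ = ∫⁻ ω in s, X m ω ∂μ := by
  induction n, hmn using Nat.le_induction with
  | base => rfl
  | succ n hmn ih => rw [hX.setLIntegral_succ n (hdm.trans hmn) s (𝒢.mono hmn s hs), ih]

theorem lintegral_eq (hX : IsNonnegMartingaleFrom μ 𝒢 d X) {m n : ℕ} (hdm : d ≤ m)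
    (hmn : m ≤ n) : ∫⁻ ω, X n ω ∂μ = ∫⁻ ω, X m ω ∂μ := by
  simpa only [setLIntegral_univ] using hX.setLIntegral_eq hdm hmn (s := Set.univ) MeasurableSet.univ

/-- Ville's maximal inequality. The event is decomposed according to the first time at which `X`
reaches the level `c`. -/
theorem mul_measure_inter_exists_le (hX : IsNonnegMartingaleFrom μ 𝒢 d X) {I : Set Ω}
    (hI : MeasurableSet[𝒢 d] I) (c : ℝ≥0∞) :
    c * μ (I ∩ {ω | ∃ n, d ≤ n ∧ c ≤ X n ω}) ≤ ∫⁻ ω in I, X d ω ∂μ := by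
  set B : ℕ → Set Ω := fun n => I ∩ {ω | c ≤ X (d + n) ω}
  have hunion : I ∩ {ω | ∃ n, d ≤ n ∧ c ≤ X n ω} = ⋃ n, disjointed B n := by
    ext ω
    simp [B, iUnion_disjointed, le_iff_exists_add]
  have hB (n : ℕ) : MeasurableSet[𝒢 (d + n)] (B n) :=
    MeasurableSet.inter (𝒢.mono (Nat.le_add_right d n) I hI)
      (hX.measurable _ (Nat.le_add_right d n) measurableSet_Ici)
  have hfirst (n : ℕ) : MeasurableSet[𝒢 (d + n)] (disjointed B n) :=
    disjointed_eq_inter_compl B n ▸ MeasurableSet.inter (hB n)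
      (MeasurableSet.iInter fun i => MeasurableSet.iInter fun hi =>
        MeasurableSet.compl (𝒢.mono (Nat.add_le_add_left hi.le d) _ (hB i)))
  rw [hunion, measure_iUnion (disjoint_disjointed B) fun n => 𝒢.le _ _ (hfirst n),
    ← ENNReal.tsum_mul_left]
  refine ENNReal.tsum_le_of_sum_range_le fun N => ?_
  calc ∑ n ∈ Finset.range N, c * μ (disjointed B n)
      ≤ ∑ n ∈ Finset.range N, ∫⁻ ω in disjointed B n, X (d + N) ω ∂μ := by
        refine Finset.sum_le_sum fun n hn => ?_
        rw [hX.setLIntegral_eq (Nat.le_add_right d n)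
          (Nat.add_le_add_left (Finset.mem_range.1 hn).le d) (hfirst n), ← setLIntegral_const]
        exact setLIntegral_mono' (𝒢.le _ _ (hfirst n)) fun ω hω => (disjointed_subset B n hω).2
    _ = ∫⁻ ω in ⋃ n ∈ Finset.range N, disjointed B n, X (d + N) ω ∂μ :=
        (lintegral_biUnion_finset (fun i _ j _ hij => disjoint_disjointed B hij)
          (fun n _ => 𝒢.le _ _ (hfirst n)) _).symm
    _ ≤ ∫⁻ ω in I, X (d + N) ω ∂μ := lintegral_mono_set
        (Set.iUnion₂_subset fun n _ => (disjointed_subset B n).trans Set.inter_subset_left)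
    _ = ∫⁻ ω in I, X d ω ∂μ := hX.setLIntegral_eq le_rfl (Nat.le_add_right d N) hI

theorem setLIntegral_inter_mul (hX : IsNonnegMartingaleFrom μ 𝒢 d X)
    (hY : IsNonnegMartingaleFrom μ 𝒦 d Y) (hind : ∀ n, Indep (𝒢 n) (𝒦 n) μ) {m n : ℕ}
    (hdm : d ≤ m) (hmn : m ≤ n) {s t : Set Ω} (hs : MeasurableSet[𝒢 m] s)
    (ht : MeasurableSet[𝒦 m] t) :
    ∫⁻ ω in s ∩ t, X n ω * Y n ω ∂μ = (∫⁻ ω in s, X m ω ∂μ) * ∫⁻ ω in t, Y m ω ∂μ := by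
  have hdn := hdm.trans hmn
  rw [setLIntegral_inter_mul_of_indep (𝒢.le n) (𝒦.le n) (hind n) (hX.measurable n hdn)
    (hY.measurable n hdn) (𝒢.mono hmn s hs) (𝒦.mono hmn t ht), hX.setLIntegral_eq hdm hmn hs,
    hY.setLIntegral_eq hdm hmn ht]

theorem mul (hX : IsNonnegMartingaleFrom μ 𝒢 d X) (hY : IsNonnegMartingaleFrom μ 𝒦 d Y)
    (hind : ∀ n, Indep (𝒢 n) (𝒦 n) μ) (hXd : ∫⁻ ω, X d ω ∂μ ≠ ∞) (hYd : ∫⁻ ω, Y d ω ∂μ ≠ ∞) :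
    IsNonnegMartingaleFrom μ (𝒢 ⊔ 𝒦) d fun n ω => X n ω * Y n ω where
  measurable n hn :=
    have hXn : Measurable[𝒢 n ⊔ 𝒦 n] (X n) := (hX.measurable n hn).mono le_sup_left le_rfl
    have hYn : Measurable[𝒢 n ⊔ 𝒦 n] (Y n) := (hY.measurable n hn).mono le_sup_right le_rfl
    hXn.mul hYn
  setLIntegral_succ n hn s hs := by
    refine setLIntegral_eq_of_forall_inter (𝒢.le n) (𝒦.le n) ?_ (fun s t hs ht => ?_) hs
    · rw [← setLIntegral_univ, ← Set.inter_self Set.univ,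
        hX.setLIntegral_inter_mul hY hind hn n.le_succ MeasurableSet.univ MeasurableSet.univ,
        setLIntegral_univ, setLIntegral_univ, hX.lintegral_eq le_rfl hn, hY.lintegral_eq le_rfl hn]
      exact ENNReal.mul_ne_top hXd hYd
    · rw [hX.setLIntegral_inter_mul hY hind hn n.le_succ hs ht,
        hX.setLIntegral_inter_mul hY hind hn le_rfl hs ht]

end IsNonnegMartingaleFrom

end NonnegMartingale

/-! ### The exponential martingale of a Markov additive process -/

section ExpMartingale

open scoped ENNReal

theorem sum_lintegral_exp_mul_eq {E : Type*} [Fintype E] {F : E → E → Measure ℝ} {θ κ : ℝ}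
    {h : E → ℝ} (hh : ∀ i, 0 ≤ h i) (hθ : θ ∈ expDomain F)
    (heig : (expMatrix F θ).mulVec h = Real.exp κ • h) (i : E) :
    ∑ j, (∫⁻ x, ENNReal.ofReal (Real.exp (θ * x)) ∂F i j) * ENNReal.ofReal (h j) =
      ENNReal.ofReal (Real.exp κ * h i) := by
  have hrow : ∑ j, (∫ x, Real.exp (θ * x) ∂F i j) * h j = Real.exp κ * h i := congrFun heig i
  have hexp (j : E) : 0 ≤ ∫ x, Real.exp (θ * x) ∂F i j :=
    integral_nonneg fun _ => (Real.exp_pos _).le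
  rw [← hrow, ENNReal.ofReal_sum_of_nonneg fun j _ => mul_nonneg (hexp j) (hh j)]
  refine Finset.sum_congr rfl fun j _ => ?_
  rw [← ofReal_integral_eq_lintegral_ofReal (hθ i j) (ae_of_all _ fun _ => (Real.exp_pos _).le),
    ENNReal.ofReal_mul (hexp j)]

section History

variable {Ω E : Type*} [MeasurableSpace E] {J : ℕ → Ω → E} {S : ℕ → Ω → ℝ}

theorem history_mono : Monotone (history J S) := fun _ _ hst =>
  biSup_mono fun _ hi => le_trans (Set.mem_Iic.1 hi) hst

theorem measurable_history_pair {s t : ℕ} (hst : s ≤ t) :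
    Measurable[history J S t] fun ω => (J s ω, S s ω) :=
  (comap_measurable _).mono (le_iSup₂_of_le s hst le_rfl) le_rfl

theorem measurable_history_state {s t : ℕ} (hst : s ≤ t) : Measurable[history J S t] (J s) :=
  measurable_fst.comp (measurable_history_pair hst)

theorem measurable_history_additive {s t : ℕ} (hst : s ≤ t) : Measurable[history J S t] (S s) :=
  measurable_snd.comp (measurable_history_pair hst)

theorem measurable_history_exp_cumul {s t : ℕ} (hst : s ≤ t) (θ c : ℝ) :
    Measurable[history J S t] fun ω => Real.exp (θ * cumul (S · ω) s t - c) :=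
  Real.measurable_exp.comp ((((measurable_history_additive le_rfl).sub
    (measurable_history_additive hst)).const_mul θ).sub_const c)

theorem history_le_comap_path (t : ℕ) :
    history J S t ≤ MeasurableSpace.comap (fun ω s => (J s ω, S s ω)) MeasurableSpace.pi :=
  iSup₂_le fun s _ => measurable_iff_comap_le.1 <|
    (measurable_pi_apply s).comp (comap_measurable fun ω s => (J s ω, S s ω))

theorem history_neg (t : ℕ) : history J (fun s ω => -S s ω) t = history J S t := by
  refine iSup_congr fun s => iSup_congr fun _ => ?_
  have hneg : MeasurableEmbedding (Prod.map id Neg.neg : E × ℝ → E × ℝ) :=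
    ((MeasurableEquiv.refl E).prodCongr (MeasurableEquiv.neg ℝ)).measurableEmbedding
  conv_rhs => rw [← hneg.comap_eq, MeasurableSpace.comap_comp]
  rfl

end History

variable {Ω E : Type*} [MeasurableSpace E] {J : ℕ → Ω → E} {S : ℕ → Ω → ℝ}
  [mΩ : MeasurableSpace Ω] [Fintype E] {μ : Measure Ω} {F : E → E → Measure ℝ}

theorem IsProcess.neg (hS : IsProcess μ F J S) :
    IsProcess μ (negKernel F) J fun t ω => -S t ω where
  measurable_state := hS.measurable_state
  measurable_additive t := (hS.measurable_additive t).neg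
  start_zero ω := by rw [hS.start_zero, neg_zero]
  markov_additive t f g hf hfb := by
    have hneg : MeasurableEmbedding fun x : ℝ => -x := (MeasurableEquiv.neg ℝ).measurableEmbedding
    have hstep := hS.markov_additive t (fun x => f (-x)) g (hf.comp measurable_neg)
      (hfb.imp fun _ hC x => hC (-x))
    simpa only [history_neg, negKernel, hneg.integral_map, neg_sub_neg, neg_sub] using hstep

/-- The filtration `σ((J_0, S(0)), …, (J_t, S(t)))` of a Markov additive process. -/
def IsProcess.filtration (hS : IsProcess μ F J S) : Filtration ℕ mΩ where
  seq := history J S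
  mono' := history_mono
  le' _ := iSup₂_le fun s _ =>
    ((hS.measurable_state s).prodMk (hS.measurable_additive s)).comap_le

theorem setLIntegral_eq_sum_inter_preimage_singleton [MeasurableSingletonClass E] {f : Ω → E}
    (hf : Measurable f) {s : Set Ω} (hs : MeasurableSet s) (φ : Ω → ℝ≥0∞) :
    ∫⁻ ω in s, φ ω ∂μ = ∑ i, ∫⁻ ω in s ∩ f ⁻¹' {i}, φ ω ∂μ := by
  have hcover : s = ⋃ i ∈ Finset.univ, s ∩ f ⁻¹' {i} := by
    ext ω
    simp
  conv_lhs => rw [hcover]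
  exact lintegral_biUnion_finset
    (fun i _ j _ hij => (Disjoint.preimage f (Set.disjoint_singleton.2 hij)).mono
      Set.inter_subset_right Set.inter_subset_right)
    (fun i _ => hs.inter (hf (measurableSet_singleton i))) φ

namespace IsProcess

variable [MeasurableSingletonClass E] [IsFiniteMeasure μ]

theorem measureReal_inter_step (hS : IsProcess μ F J S) (t : ℕ) (i j : E) {H : Set Ω}
    (hH : MeasurableSet[history J S t] H) {B : Set ℝ} (hB : MeasurableSet B) :
    μ.real ((fun ω => S (t + 1) ω - S t ω) ⁻¹' B ∩ J (t + 1) ⁻¹' {j} ∩ (H ∩ J t ⁻¹' {i})) =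
      μ.real (H ∩ J t ⁻¹' {i}) * (F i j).real B := by
  have hle := hS.filtration.le t
  have hHi : MeasurableSet[history J S t] (H ∩ J t ⁻¹' {i}) :=
    MeasurableSet.inter hH (measurable_history_state le_rfl (measurableSet_singleton i))
  have hnext : MeasurableSet ((fun ω => S (t + 1) ω - S t ω) ⁻¹' B ∩ J (t + 1) ⁻¹' {j}) :=
    (((hS.measurable_additive _).sub (hS.measurable_additive _)) hB).inter
      (hS.measurable_state _ (measurableSet_singleton j))
  have hprod : (fun ω => B.indicator (1 : ℝ → ℝ) (S (t + 1) ω - S t ω) *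
      Set.indicator {j} (1 : E → ℝ) (J (t + 1) ω)) =
      ((fun ω => S (t + 1) ω - S t ω) ⁻¹' B ∩ J (t + 1) ⁻¹' {j}).indicator 1 := by
    rw [Set.inter_indicator_one]
    rfl
  have hcond := hS.markov_additive t (B.indicator 1) (Set.indicator {j} 1)
    (measurable_one.indicator hB) ⟨1, fun x => by by_cases hx : x ∈ B <;> simp [hx]⟩
  have hmean := setIntegral_condExp (μ := μ) hle (f := Set.indicator _ (1 : Ω → ℝ))
    ((integrable_const (1 : ℝ)).indicator hnext) hHi
  rw [← measureReal_restrict_apply hnext, ← integral_indicator_one hnext, ← hmean, ← hprod,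
    ← smul_eq_mul, ← setIntegral_const]
  refine setIntegral_congr_ae (hle _ hHi) (hcond.mono fun ω hω hωi => ?_)
  refine hω.trans ?_
  beta_reduce
  rw [show J t ω = i from hωi.2, Finset.sum_eq_single j (by simp +contextual) (by simp)]
  simp [integral_indicator_one hB]

variable [∀ i j, IsFiniteMeasure (F i j)]

theorem map_restrict_increment (hS : IsProcess μ F J S) (t : ℕ) (i j : E) {H : Set Ω}
    (hH : MeasurableSet[history J S t] H) :
    (μ.restrict (H ∩ J t ⁻¹' {i} ∩ J (t + 1) ⁻¹' {j})).map (fun ω => S (t + 1) ω - S t ω) =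
      μ (H ∩ J t ⁻¹' {i}) • F i j := by
  have hΔ : Measurable fun ω => S (t + 1) ω - S t ω :=
    (hS.measurable_additive _).sub (hS.measurable_additive _)
  ext B hB
  rw [Measure.map_apply hΔ hB, Measure.restrict_apply (hΔ hB), Set.inter_comm (H ∩ _),
    ← Set.inter_assoc, Measure.smul_apply, smul_eq_mul, ← ENNReal.toReal_eq_toReal_iff'
      (measure_ne_top _ _) (ENNReal.mul_ne_top (measure_ne_top _ _) (measure_ne_top _ _)),
    ENNReal.toReal_mul]
  exact hS.measureReal_inter_step t i j hH hB

theorem setLIntegral_step (hS : IsProcess μ F J S) (t : ℕ) {H : Set Ω}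
    (hH : MeasurableSet[history J S t] H) {f : ℝ → ℝ≥0∞} (hf : Measurable f) (g : E → ℝ≥0∞) :
    ∫⁻ ω in H, f (S (t + 1) ω - S t ω) * g (J (t + 1) ω) ∂μ =
      ∫⁻ ω in H, ∑ j, (∫⁻ x, f x ∂F (J t ω) j) * g j ∂μ := by
  have hHΩ : MeasurableSet H := hS.filtration.le t H hH
  have hJ (s : ℕ) (i : E) : MeasurableSet (J s ⁻¹' {i}) :=
    hS.measurable_state s (measurableSet_singleton i)
  have hΔ : Measurable fun ω => S (t + 1) ω - S t ω :=
    (hS.measurable_additive _).sub (hS.measurable_additive _)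
  simp only [setLIntegral_eq_sum_inter_preimage_singleton (hS.measurable_state t) hHΩ]
  refine Finset.sum_congr rfl fun i _ => ?_
  have hfiber (j : E) :
      ∫⁻ ω in H ∩ J t ⁻¹' {i} ∩ J (t + 1) ⁻¹' {j}, f (S (t + 1) ω - S t ω) * g (J (t + 1) ω) ∂μ =
        (∫⁻ x, f x ∂F i j) * g j * μ (H ∩ J t ⁻¹' {i}) := by
    rw [setLIntegral_congr_fun (g := fun ω => f (S (t + 1) ω - S t ω) * g j)
        ((hHΩ.inter (hJ t i)).inter (hJ (t + 1) j)) fun ω hω => by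
          rw [show J (t + 1) ω = j from hω.2],
      lintegral_mul_const _ (hf.fun_comp hΔ), ← lintegral_map hf hΔ,
      hS.map_restrict_increment t i j hH, lintegral_smul_measure, smul_eq_mul]
    ring
  rw [setLIntegral_eq_sum_inter_preimage_singleton (hS.measurable_state (t + 1))
      (hHΩ.inter (hJ t i)),
    setLIntegral_congr_fun (g := fun _ => ∑ j, (∫⁻ x, f x ∂F i j) * g j) (hHΩ.inter (hJ t i))
      fun ω hω => by rw [show J t ω = i from hω.2],
    setLIntegral_const, Finset.sum_mul]
  exact Finset.sum_congr rfl fun j _ => hfiber j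

end IsProcess

/-- The exponential martingale `e^{θ (S(n) - S(d)) - (n - d) κ} h(J_n)`, started at time `d`.
It is meant for `n ≥ d`. -/
noncomputable def expMartingale (J : ℕ → Ω → E) (S : ℕ → Ω → ℝ) (θ κ : ℝ) (h : E → ℝ) (d n : ℕ)
    (ω : Ω) : ℝ≥0∞ :=
  ENNReal.ofReal (Real.exp (θ * cumul (S · ω) d n - (n - d) * κ) * h (J n ω))

theorem IsProcess.isNonnegMartingaleFrom_expMartingale [MeasurableSingletonClass E]
    [IsFiniteMeasure μ] [∀ i j, IsFiniteMeasure (F i j)] (hS : IsProcess μ F J S) {θ κ : ℝ}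
    {h : E → ℝ} (hh : ∀ i, 0 ≤ h i) (hθ : θ ∈ expDomain F)
    (heig : (expMatrix F θ).mulVec h = Real.exp κ • h) (d : ℕ) :
    IsNonnegMartingaleFrom μ hS.filtration d (expMartingale J S θ κ h d) := by
  refine ⟨fun n hn => ENNReal.measurable_ofReal.comp
    ((measurable_history_exp_cumul hn θ _).mul
      ((measurable_of_finite h).comp (measurable_history_state le_rfl))), fun n hn s hs => ?_⟩
  have hexp : Measurable fun x : ℝ => ENNReal.ofReal (Real.exp (θ * x)) := by fun_prop
  have hJ (t : ℕ) (φ : E → ℝ≥0∞) : Measurable fun ω => φ (J t ω) :=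
    (measurable_of_finite φ).comp (hS.measurable_state t)
  have hnext : Measurable fun ω => ENNReal.ofReal (Real.exp (θ * (S (n + 1) ω - S n ω))) *
      ENNReal.ofReal (h (J (n + 1) ω)) :=
    (hexp.comp ((hS.measurable_additive (n + 1)).sub (hS.measurable_additive n))).mul
      (hJ (n + 1) fun j => ENNReal.ofReal (h j))
  calc ∫⁻ ω in s, expMartingale J S θ κ h d (n + 1) ω ∂μ
      = ∫⁻ ω in s, ENNReal.ofReal (Real.exp (θ * cumul (S · ω) d n - (n + 1 - d) * κ)) *
          (ENNReal.ofReal (Real.exp (θ * (S (n + 1) ω - S n ω))) *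
            ENNReal.ofReal (h (J (n + 1) ω))) ∂μ := by
        refine lintegral_congr fun ω => ?_
        rw [expMartingale, ← ENNReal.ofReal_mul (Real.exp_pos _).le,
          ← ENNReal.ofReal_mul (Real.exp_pos _).le, ← mul_assoc, ← Real.exp_add]
        congr 3
        push_cast [cumul]
        ring
    _ = ∫⁻ ω in s, ENNReal.ofReal (Real.exp (θ * cumul (S · ω) d n - (n + 1 - d) * κ)) *
          ∑ j, (∫⁻ x, ENNReal.ofReal (Real.exp (θ * x)) ∂F (J n ω) j) *
            ENNReal.ofReal (h j) ∂μ :=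
        setLIntegral_mul_eq_of_forall_setLIntegral_eq (hS.filtration.le n) hnext
          (hJ n fun i => ∑ j, (∫⁻ x, ENNReal.ofReal (Real.exp (θ * x)) ∂F i j) *
            ENNReal.ofReal (h j))
          (fun H hH => hS.setLIntegral_step n hH hexp fun j => ENNReal.ofReal (h j))
          (ENNReal.measurable_ofReal.comp (measurable_history_exp_cumul hn θ ((n + 1 - d) * κ))) hs
    _ = ∫⁻ ω in s, expMartingale J S θ κ h d n ω ∂μ := by
        refine lintegral_congr fun ω => ?_
        rw [sum_lintegral_exp_mul_eq hh hθ heig, expMartingale,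
          ← ENNReal.ofReal_mul (Real.exp_pos _).le, ← mul_assoc, ← Real.exp_add]
        congr 3
        ring

end ExpMartingale

/-! ### Exponential bounds for two independent Markov additive processes -/

section ExceedanceBound

open scoped ENNReal

theorem cond_real_le_div_of_mul_measure_inter_le {Ω : Type*} [MeasurableSpace Ω] {μ : Measure Ω}
    [IsFiniteMeasure μ] {I A : Set Ω} (hI : MeasurableSet I) {a c : ℝ} (ha : 0 ≤ a) (hc : 0 < c)
    (h : ENNReal.ofReal c * μ (I ∩ A) ≤ ENNReal.ofReal a * μ I) : (cond μ I).real A ≤ a / c := by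
  have hreal : c * μ.real (I ∩ A) ≤ a * μ.real I := by
    have hmono := ENNReal.toReal_mono
      (ENNReal.mul_ne_top ENNReal.ofReal_ne_top (measure_ne_top μ I)) h
    rwa [ENNReal.toReal_mul, ENNReal.toReal_mul, ENNReal.toReal_ofReal hc.le,
      ENNReal.toReal_ofReal ha] at hmono
  rw [measureReal_def, cond_apply hI, ENNReal.toReal_mul, ENNReal.toReal_inv, ← measureReal_def,
    ← measureReal_def]
  rcases (measureReal_nonneg (μ := μ) (s := I)).eq_or_lt with hnull | hpos
  · rw [← hnull, inv_zero, zero_mul]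
    positivity
  · rw [inv_mul_le_iff₀ hpos, ← mul_div_assoc, le_div_iff₀ hc]
    linarith

variable {Ω E E' : Type*} {J : ℕ → Ω → E} {X : ℕ → Ω → ℝ} {K : ℕ → Ω → E'} {Y : ℕ → Ω → ℝ}

theorem expMartingale_self (J : ℕ → Ω → E) (X : ℕ → Ω → ℝ) (θ κ : ℝ) (h : E → ℝ) (d : ℕ) (ω : Ω) :
    expMartingale J X θ κ h d d ω = ENNReal.ofReal (h (J d ω)) := by
  simp [expMartingale, cumul]

/-- The event that `X(d,t) + Y(0,t)` exceeds the level `b` at some time `t ≥ d` in `T`. With `X = A`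
and `Y = -S` these are the delay (`b = 0`) and backlog (`d = 0`) events. -/
def exceedsDuring (X Y : ℕ → Ω → ℝ) (d : ℕ) (b : ℝ) (T : Set ℕ) : Set Ω :=
  {ω | ∃ t ∈ T, d ≤ t ∧ b < cumul (X · ω) d t + cumul (Y · ω) 0 t}

theorem ofReal_le_expMartingale_mul_expMartingale {θ κ κ' b c m m' : ℝ} {h : E → ℝ} {h' : E' → ℝ}
    (hθ : 0 ≤ θ) (hm : 0 ≤ m) (hm' : 0 ≤ m') (hmh : ∀ i, m ≤ h i) (hmh' : ∀ i, m' ≤ h' i)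
    {d t : ℕ} {ω : Ω} (hb : b < cumul (X · ω) d t + cumul (Y · ω) 0 t)
    (hc : c ≤ θ * b + d * κ - t * (κ + κ')) :
    ENNReal.ofReal (m * m' * Real.exp c) ≤
      expMartingale J X θ κ h d t ω * expMartingale K Y θ κ' h' 0 t ω := by
  have hθb : θ * b ≤ θ * (cumul (X · ω) d t + cumul (Y · ω) 0 t) :=
    mul_le_mul_of_nonneg_left hb.le hθ
  have hh := hm.trans (hmh (J t ω))
  have hh' := hm'.trans (hmh' (K t ω))
  rw [expMartingale, expMartingale, ← ENNReal.ofReal_mul (mul_nonneg (Real.exp_pos _).le hh)]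
  refine ENNReal.ofReal_le_ofReal ?_
  calc m * m' * Real.exp c
      ≤ h (J t ω) * h' (K t ω) * Real.exp
        (θ * cumul (X · ω) d t - (t - d) * κ + (θ * cumul (Y · ω) 0 t - (t - (0 : ℕ)) * κ')) := by
        gcongr
        · exact hmh _
        · exact hmh' _
        · push_cast
          linarith
    _ = _ := by
        rw [Real.exp_add]
        ring

variable [MeasurableSpace Ω]

theorem lintegral_ofReal_comp_ne_top {μ : Measure Ω} [IsFiniteMeasure μ] [Finite E] (f : Ω → E)
    (v : E → ℝ) : ∫⁻ ω, ENNReal.ofReal (v (f ω)) ∂μ ≠ ∞ := by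
  obtain ⟨C, hC⟩ := (Set.finite_range v).bddAbove
  refine ne_top_of_le_ne_top ?_ (lintegral_mono fun ω =>
    ENNReal.ofReal_le_ofReal (hC (Set.mem_range_self (f ω))))
  rw [lintegral_const]
  exact ENNReal.mul_ne_top ENNReal.ofReal_ne_top (measure_ne_top _ _)

variable [Fintype E] [MeasurableSpace E] [MeasurableSingletonClass E]
  [Fintype E'] [MeasurableSpace E'] [MeasurableSingletonClass E']
  {μ : Measure Ω} [IsFiniteMeasure μ] {F : E → E → Measure ℝ} {G : E' → E' → Measure ℝ}
  [∀ i j, IsFiniteMeasure (F i j)] [∀ i j, IsFiniteMeasure (G i j)]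
  {θ κ κ' : ℝ} {h : E → ℝ} {h' : E' → ℝ}

theorem IsProcess.setLIntegral_expMartingale_preimage_singleton (hX : IsProcess μ F J X)
    (hh : ∀ i, 0 ≤ h i) (hθ : θ ∈ expDomain F)
    (heig : (expMatrix F θ).mulVec h = Real.exp κ • h) {d n : ℕ} (hdn : d ≤ n) (i : E) :
    ∫⁻ ω in J d ⁻¹' {i}, expMartingale J X θ κ h d n ω ∂μ =
      ENNReal.ofReal (h i) * μ (J d ⁻¹' {i}) := by
  rw [(hX.isNonnegMartingaleFrom_expMartingale hh hθ heig d).setLIntegral_eq le_rfl hdn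
    (measurable_history_state le_rfl (measurableSet_singleton i)), ← setLIntegral_const]
  refine setLIntegral_congr_fun (hX.measurable_state d (measurableSet_singleton i)) fun ω hω => ?_
  rw [expMartingale_self, show J d ω = i from hω]

theorem IsProcess.lintegral_expMartingale_ne_top (hX : IsProcess μ F J X) (hh : ∀ i, 0 ≤ h i)
    (hθ : θ ∈ expDomain F) (heig : (expMatrix F θ).mulVec h = Real.exp κ • h) {d n : ℕ}
    (hdn : d ≤ n) : ∫⁻ ω, expMartingale J X θ κ h d n ω ∂μ ≠ ∞ := by
  rw [(hX.isNonnegMartingaleFrom_expMartingale hh hθ heig d).lintegral_eq le_rfl hdn]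
  simpa only [expMartingale_self] using lintegral_ofReal_comp_ne_top (J d) h

/-- The product of the exponential martingales of `X`, started at `d`, and of `Y`, started at `0`,
is a martingale from time `d` on, to which Ville's inequality applies. -/
theorem mul_measure_inter_exceedsDuring_le (hX : IsProcess μ F J X) (hY : IsProcess μ G K Y)
    (hindep : IndepFun (fun ω t => (J t ω, X t ω)) (fun ω t => (K t ω, Y t ω)) μ) (hθ : 0 ≤ θ)
    (hθF : θ ∈ expDomain F) (hθG : θ ∈ expDomain G)
    (heig : (expMatrix F θ).mulVec h = Real.exp κ • h)
    (heig' : (expMatrix G θ).mulVec h' = Real.exp κ' • h') {m m' : ℝ} (hm : 0 ≤ m) (hm' : 0 ≤ m')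
    (hmh : ∀ i, m ≤ h i) (hmh' : ∀ i, m' ≤ h' i) (d : ℕ) (i : E) (i' : E') {T : Set ℕ} {b c : ℝ}
    (hc : ∀ t ∈ T, d ≤ t → c ≤ θ * b + d * κ - t * (κ + κ')) :
    ENNReal.ofReal (m * m' * Real.exp c) *
        μ (J d ⁻¹' {i} ∩ K 0 ⁻¹' {i'} ∩ exceedsDuring X Y d b T) ≤
      ENNReal.ofReal (h i * h' i') * μ (J d ⁻¹' {i} ∩ K 0 ⁻¹' {i'}) := by
  have hh i := hm.trans (hmh i)
  have hh' i := hm'.trans (hmh' i)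
  have hind n : Indep (hX.filtration n) (hY.filtration n) μ :=
    indep_of_indep_of_le_left (indep_of_indep_of_le_right hindep (history_le_comap_path n))
      (history_le_comap_path n)
  have hMX := hX.isNonnegMartingaleFrom_expMartingale hh hθF heig d
  have hMY := (hY.isNonnegMartingaleFrom_expMartingale hh' hθG heig' 0).of_le (Nat.zero_le d)
  have hM := hMX.mul hMY hind (hX.lintegral_expMartingale_ne_top hh hθF heig le_rfl)
    (hY.lintegral_expMartingale_ne_top hh' hθG heig' (Nat.zero_le d))
  have hi : MeasurableSet[hX.filtration d] (J d ⁻¹' {i}) :=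
    measurable_history_state le_rfl (measurableSet_singleton i)
  have hi' : MeasurableSet[hY.filtration d] (K 0 ⁻¹' {i'}) :=
    measurable_history_state (Nat.zero_le d) (measurableSet_singleton i')
  have hI : MeasurableSet[(hX.filtration ⊔ hY.filtration) d] (J d ⁻¹' {i} ∩ K 0 ⁻¹' {i'}) :=
    MeasurableSet.inter (m := hX.filtration d ⊔ hY.filtration d)
      (le_sup_left (b := hY.filtration d) _ hi) (le_sup_right (a := hX.filtration d) _ hi')
  have hstart : ∫⁻ ω in J d ⁻¹' {i} ∩ K 0 ⁻¹' {i'},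
      expMartingale J X θ κ h d d ω * expMartingale K Y θ κ' h' 0 d ω ∂μ =
      ENNReal.ofReal (h i * h' i') * μ (J d ⁻¹' {i} ∩ K 0 ⁻¹' {i'}) := by
    rw [hMX.setLIntegral_inter_mul hMY hind le_rfl le_rfl hi hi',
      hX.setLIntegral_expMartingale_preimage_singleton hh hθF heig le_rfl,
      hY.setLIntegral_expMartingale_preimage_singleton hh' hθG heig' (Nat.zero_le d),
      (Indep_iff _ _ μ).1 (hind d) _ _ hi hi', ENNReal.ofReal_mul (hh i), mul_mul_mul_comm]
  refine le_trans ?_ ((hM.mul_measure_inter_exists_le hI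
    (ENNReal.ofReal (m * m' * Real.exp c))).trans hstart.le)
  gcongr
  rintro ω ⟨t, ht, hdt, hb⟩
  exact ⟨t, hdt,
    ofReal_le_expMartingale_mul_expMartingale hθ hm hm' hmh hmh' hb (hc t ht hdt)⟩

variable [DecidableEq E] [DecidableEq E']

theorem cond_real_exceedsDuring_le (hX : IsProcess μ F J X) (hY : IsProcess μ G K Y)
    (hindep : IndepFun (fun ω t => (J t ω, X t ω)) (fun ω t => (K t ω, Y t ω)) μ) (hθ : 0 ≤ θ)
    (hθF : θ ∈ expDomain F) (hθG : θ ∈ expDomain G) (hh : IsPerronVector F θ h)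
    (hh' : IsPerronVector G θ h') (d : ℕ) (i : E) (i' : E') {T : Set ℕ} {b c : ℝ}
    (hc : ∀ t ∈ T, d ≤ t → c ≤ θ * b + d * kappa F θ - t * (kappa F θ + kappa G θ)) :
    (cond μ {ω | J d ω = i ∧ K 0 ω = i'}).real (exceedsDuring X Y d b T) ≤
      h i * h' i' / ((⨅ j, h j) * ⨅ j, h' j) * Real.exp (-c) := by
  have : Nonempty E := ⟨i⟩
  have : Nonempty E' := ⟨i'⟩
  obtain ⟨k, hk⟩ := exists_eq_ciInf_of_finite (f := h)
  obtain ⟨k', hk'⟩ := exists_eq_ciInf_of_finite (f := h')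
  have hmin j : h k ≤ h j := hk ▸ ciInf_le (Set.finite_range h).bddBelow j
  have hmin' j : h' k' ≤ h' j := hk' ▸ ciInf_le (Set.finite_range h').bddBelow j
  rw [← hk, ← hk', Real.exp_neg, ← div_eq_mul_inv, div_div]
  exact cond_real_le_div_of_mul_measure_inter_le
    ((hX.measurable_state d (measurableSet_singleton i)).inter
      (hY.measurable_state 0 (measurableSet_singleton i')))
    (mul_pos (hh.1 i) (hh'.1 i')).le
    (mul_pos (mul_pos (hh.1 k) (hh'.1 k')) (Real.exp_pos c))
    (mul_measure_inter_exceedsDuring_le hX hY hindep hθ hθF hθG hh.2 hh'.2 (hh.1 k).le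
      (hh'.1 k').le hmin hmin' d i i' hc)

end ExceedanceBound

/-! ### The sign of `κ^A + κ^{-S}` at the tilting parameter -/

section DecayRate

variable {E E' : Type*} [Fintype E] [DecidableEq E] [Fintype E'] [DecidableEq E']
  {F : E → E → Measure ℝ} {G : E' → E' → Measure ℝ} {γ θ y : ℝ}

/-- `γ` is the positive root of `κ^A + κ^{-S}` at which the sum crosses zero upwards, for the
kernels `F` of `A` and `G` of `-S`. It is the exponential decay rate of the backlog in infinite
time. -/
structure IsDecayRate (F : E → E → Measure ℝ) (G : E' → E' → Measure ℝ) (γ : ℝ) : Prop where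
  pos : 0 < γ
  mem_interior : γ ∈ interior (expDomain F ∩ expDomain G)
  kappa_add_eq_zero : kappa F γ + kappa G γ = 0
  deriv_pos : 0 < deriv (kappa F) γ + deriv (kappa G) γ

variable [∀ i j, IsFiniteMeasure (F i j)] [∀ i j, IsFiniteMeasure (G i j)]
  [Nonempty E] [Nonempty E']

theorem deriv_kappa_nonneg (hirr : (transitionMatrix F).IsIrreducible)
    (hnonneg : ∀ i j, ∀ᵐ x ∂(F i j), 0 ≤ x) (hθ : θ ∈ interior (expDomain F)) :
    0 ≤ deriv (kappa F) θ := by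
  rw [← derivWithin_of_mem_nhds (mem_interior_iff_mem_nhds.1 hθ)]
  exact (monotoneOn_kappa hirr hnonneg).derivWithin_nonneg

theorem convexOn_smul_kappa_add_smul_kappa (hirrF : (transitionMatrix F).IsIrreducible)
    (hirrG : (transitionMatrix G).IsIrreducible) {a b : ℝ} (ha : 0 ≤ a) (hb : 0 ≤ b) :
    ConvexOn ℝ (expDomain F ∩ expDomain G) (a • kappa F + b • kappa G) :=
  have hconv := (convex_expDomain F).inter (convex_expDomain G)
  (((convexOn_kappa hirrF).subset Set.inter_subset_left hconv).smul ha).add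
    (((convexOn_kappa hirrG).subset Set.inter_subset_right hconv).smul hb)

theorem convexOn_kappa_add_kappa (hirrF : (transitionMatrix F).IsIrreducible)
    (hirrG : (transitionMatrix G).IsIrreducible) :
    ConvexOn ℝ (expDomain F ∩ expDomain G) (kappa F + kappa G) := by
  simpa using convexOn_smul_kappa_add_smul_kappa hirrF hirrG zero_le_one zero_le_one

theorem convexOn_smul_kappa_add_kappa_sub_kappa (hirrF : (transitionMatrix F).IsIrreducible)
    (hirrG : (transitionMatrix G).IsIrreducible) (hy : 1 ≤ y) :
    ConvexOn ℝ (expDomain F ∩ expDomain G) (y • (kappa F + kappa G) - kappa F) := by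
  convert convexOn_smul_kappa_add_smul_kappa hirrF hirrG (sub_nonneg.2 hy)
    (zero_le_one.trans hy) using 1
  module

theorem convexOn_smul_kappa_add_kappa_sub_id (hirrF : (transitionMatrix F).IsIrreducible)
    (hirrG : (transitionMatrix G).IsIrreducible) (hy : 0 ≤ y) :
    ConvexOn ℝ (expDomain F ∩ expDomain G) (y • (kappa F + kappa G) - id) :=
  have hconv := convexOn_kappa_add_kappa hirrF hirrG
  (hconv.smul hy).sub (concaveOn_id hconv.1)

theorem hasDerivAt_kappa_add_kappa (hirrF : (transitionMatrix F).IsIrreducible)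
    (hirrG : (transitionMatrix G).IsIrreducible) (hθ : θ ∈ interior (expDomain F ∩ expDomain G)) :
    HasDerivAt (kappa F + kappa G) (deriv (kappa F) θ + deriv (kappa G) θ) θ :=
  (differentiableAt_kappa hirrF (interior_mono Set.inter_subset_left hθ)).hasDerivAt.add
    (differentiableAt_kappa hirrG (interior_mono Set.inter_subset_right hθ)).hasDerivAt

theorem IsDecayRate.kappa_add_nonneg_of_delay (hγ : IsDecayRate F G γ)
    (hirrF : (transitionMatrix F).IsIrreducible) (hirrG : (transitionMatrix G).IsIrreducible)
    (hθ : θ ∈ interior (expDomain F ∩ expDomain G)) (hy : 1 ≤ y)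
    (hstat : y * deriv (kappa G) θ = -(y - 1) * deriv (kappa F) θ)
    (hlt : y < deriv (kappa F) γ / (deriv (kappa F) γ + deriv (kappa G) γ)) :
    0 ≤ θ ∧ 0 ≤ kappa F θ + kappa G θ := by
  have hkθ := hasDerivAt_kappa_add_kappa hirrF hirrG hθ
  have hkγ := hasDerivAt_kappa_add_kappa hirrF hirrG hγ.mem_interior
  have hdiffF {t : ℝ} (ht : t ∈ interior (expDomain F ∩ expDomain G)) :=
    differentiableAt_kappa hirrF (interior_mono Set.inter_subset_left ht)
  refine nonneg_and_nonneg_of_lt_deriv_div_deriv (convexOn_kappa_add_kappa hirrF hirrG)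
    (convexOn_smul_kappa_add_kappa_sub_kappa hirrF hirrG hy) (interior_subset hγ.mem_interior)
    (interior_subset hθ) hkθ.differentiableAt (hdiffF hγ.mem_interior) (hdiffF hθ) hγ.pos
    hγ.kappa_add_eq_zero (hkγ.deriv ▸ hγ.deriv_pos) ?_ (hkγ.deriv ▸ hlt)
  rw [hkθ.deriv]
  linarith

theorem IsDecayRate.kappa_add_nonpos_of_delay (hγ : IsDecayRate F G γ) (hF : IsKernel F)
    (hG : IsKernel G) (hirrF : (transitionMatrix F).IsIrreducible)
    (hirrG : (transitionMatrix G).IsIrreducible) (hnonneg : ∀ i j, ∀ᵐ x ∂(F i j), 0 ≤ x)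
    (hθ : θ ∈ interior (expDomain F ∩ expDomain G)) (hy : 1 ≤ y)
    (hstat : y * deriv (kappa G) θ = -(y - 1) * deriv (kappa F) θ)
    (hlt : deriv (kappa F) γ / (deriv (kappa F) γ + deriv (kappa G) γ) < y) :
    0 ≤ θ ∧ kappa F θ + kappa G θ ≤ 0 := by
  have hkθ := hasDerivAt_kappa_add_kappa hirrF hirrG hθ
  have hkγ := hasDerivAt_kappa_add_kappa hirrF hirrG hγ.mem_interior
  have hdiffF {t : ℝ} (ht : t ∈ interior (expDomain F ∩ expDomain G)) :=
    differentiableAt_kappa hirrF (interior_mono Set.inter_subset_left ht)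
  refine nonneg_and_nonpos_of_deriv_div_deriv_lt (convexOn_kappa_add_kappa hirrF hirrG)
    (convexOn_smul_kappa_add_kappa_sub_kappa hirrF hirrG hy) (interior_subset hγ.mem_interior)
    (interior_subset hθ) hkθ.differentiableAt (hdiffF hγ.mem_interior) (hdiffF hθ) hγ.pos
    (by simp [kappa_zero hF, kappa_zero hG]) hγ.kappa_add_eq_zero (hkγ.deriv ▸ hγ.deriv_pos)
    (zero_lt_one.trans_le hy)
    (deriv_kappa_nonneg hirrF hnonneg (interior_mono Set.inter_subset_left hθ)) ?_
    (hkγ.deriv ▸ hlt)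
  rw [hkθ.deriv]
  linarith

theorem IsDecayRate.kappa_add_nonneg_of_backlog (hγ : IsDecayRate F G γ)
    (hirrF : (transitionMatrix F).IsIrreducible) (hirrG : (transitionMatrix G).IsIrreducible)
    (hθ : θ ∈ interior (expDomain F ∩ expDomain G)) (hy : 0 ≤ y)
    (hstat : y * (deriv (kappa F) θ + deriv (kappa G) θ) = 1)
    (hlt : y < 1 / (deriv (kappa F) γ + deriv (kappa G) γ)) :
    0 ≤ θ ∧ 0 ≤ kappa F θ + kappa G θ := by
  have hkθ := hasDerivAt_kappa_add_kappa hirrF hirrG hθ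
  have hkγ := hasDerivAt_kappa_add_kappa hirrF hirrG hγ.mem_interior
  exact nonneg_and_nonneg_of_lt_deriv_div_deriv (convexOn_kappa_add_kappa hirrF hirrG)
    (convexOn_smul_kappa_add_kappa_sub_id hirrF hirrG hy) (interior_subset hγ.mem_interior)
    (interior_subset hθ) hkθ.differentiableAt differentiableAt_id differentiableAt_id hγ.pos
    hγ.kappa_add_eq_zero (hkγ.deriv ▸ hγ.deriv_pos) (by rw [hkθ.deriv, hstat, deriv_id])
    (by rwa [hkγ.deriv, deriv_id])

theorem IsDecayRate.kappa_add_nonpos_of_backlog (hγ : IsDecayRate F G γ) (hF : IsKernel F)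
    (hG : IsKernel G) (hirrF : (transitionMatrix F).IsIrreducible)
    (hirrG : (transitionMatrix G).IsIrreducible)
    (hθ : θ ∈ interior (expDomain F ∩ expDomain G)) (hy : 0 < y)
    (hstat : y * (deriv (kappa F) θ + deriv (kappa G) θ) = 1)
    (hlt : 1 / (deriv (kappa F) γ + deriv (kappa G) γ) < y) :
    0 ≤ θ ∧ kappa F θ + kappa G θ ≤ 0 := by
  have hkθ := hasDerivAt_kappa_add_kappa hirrF hirrG hθ
  have hkγ := hasDerivAt_kappa_add_kappa hirrF hirrG hγ.mem_interior
  exact nonneg_and_nonpos_of_deriv_div_deriv_lt (convexOn_kappa_add_kappa hirrF hirrG)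
    (convexOn_smul_kappa_add_kappa_sub_id hirrF hirrG hy.le) (interior_subset hγ.mem_interior)
    (interior_subset hθ) hkθ.differentiableAt differentiableAt_id differentiableAt_id hγ.pos
    (by simp [kappa_zero hF, kappa_zero hG]) hγ.kappa_add_eq_zero (hkγ.deriv ▸ hγ.deriv_pos)
    hy (by simp) (by rw [hkθ.deriv, hstat, deriv_id]) (by rwa [hkγ.deriv, deriv_id])

end DecayRate

/-! ### Finite-time bounds for the queue -/

section Queue

variable {Ω E E' : Type*} {A S : ℕ → Ω → ℝ}

theorem delayExceedsBy_eq_exceedsDuring (A S : ℕ → Ω → ℝ) (d : ℕ) (T : ℝ) :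
    delayExceedsBy A S d T = exceedsDuring A (fun t ω => -S t ω) d 0 {t | (t : ℝ) ≤ T} := by
  ext ω
  simp only [delayExceedsBy, exceedsDuring, cumul, Set.mem_ofPred_eq]
  refine exists_congr fun t => ?_
  rw [and_left_comm, neg_sub_neg, sub_sub_eq_add_sub, add_sub_assoc]

theorem delayExceeds_subset_union (A S : ℕ → Ω → ℝ) (d : ℕ) (T : ℝ) :
    delayExceeds A S d ⊆
      exceedsDuring A (fun t ω => -S t ω) d 0 {t | T < t} ∪ delayExceedsBy A S d T := by
  rintro ω ⟨t, hdt, hpos⟩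
  rcases lt_or_ge T (t : ℝ) with ht | ht
  · refine Or.inl ⟨t, ht, hdt, ?_⟩
    simp only [cumul] at hpos ⊢
    linarith
  · exact Or.inr ⟨t, hdt, ht, hpos⟩

theorem backlogExceedsBy_eq_exceedsDuring (A S : ℕ → Ω → ℝ) (b T : ℝ) :
    backlogExceedsBy A S b T = exceedsDuring A (fun t ω => -S t ω) 0 b {t | (t : ℝ) ≤ T} := by
  ext ω
  simp only [backlogExceedsBy, exceedsDuring, cumul, Set.mem_ofPred_eq, Nat.zero_le, true_and]
  refine exists_congr fun t => ?_
  rw [neg_sub_neg, sub_sub_eq_add_sub, add_sub_assoc]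

theorem backlogExceeds_subset_union (A S : ℕ → Ω → ℝ) (b T : ℝ) :
    backlogExceeds A S b ⊆
      exceedsDuring A (fun t ω => -S t ω) 0 b {t | T < t} ∪ backlogExceedsBy A S b T := by
  rintro ω ⟨t, hpos⟩
  rcases lt_or_ge T (t : ℝ) with ht | ht
  · refine Or.inl ⟨t, ht, Nat.zero_le t, ?_⟩
    simp only [cumul] at hpos ⊢
    linarith
  · exact Or.inr ⟨t, ht, hpos⟩

theorem div_iInf_mul_iInf_le_delayConst_mul [Finite E] {hvA : E → ℝ} {hvS : E' → ℝ}
    (hvA_nonneg : ∀ i, 0 ≤ hvA i) (hvS_nonneg : ∀ i, 0 ≤ hvS i) (iA : E) (iS : E') :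
    hvA iA * hvS iS / ((⨅ j, hvA j) * ⨅ j, hvS j) ≤ delayConst hvA hvS * hvS iS := by
  have hsup : hvA iA ≤ ⨆ j, hvA j := le_ciSup (Set.finite_range hvA).bddAbove iA
  have hinfA : 0 ≤ ⨅ j, hvA j := Real.iInf_nonneg hvA_nonneg
  have hinfS : 0 ≤ ⨅ j, hvS j := Real.iInf_nonneg hvS_nonneg
  have hvS_iS := hvS_nonneg iS
  calc hvA iA * hvS iS / ((⨅ j, hvA j) * ⨅ j, hvS j)
      ≤ (⨆ j, hvA j) * hvS iS / ((⨅ j, hvA j) * ⨅ j, hvS j) := by gcongr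
    _ = delayConst hvA hvS * hvS iS := by
      rw [delayConst, div_mul_div_comm, mul_one, div_mul_eq_mul_div]

theorem div_iInf_mul_iInf_eq_backlogConst_mul (hvA : E → ℝ) (hvS : E' → ℝ) (iA : E) (iS : E') :
    hvA iA * hvS iS / ((⨅ j, hvA j) * ⨅ j, hvS j) =
      backlogConst hvA hvS * hvA iA * hvS iS := by
  rw [backlogConst, div_mul_div_comm, mul_one]
  ring

variable [MeasurableSpace Ω]
  [Fintype E] [DecidableEq E] [MeasurableSpace E] [MeasurableSingletonClass E]
  [Fintype E'] [DecidableEq E'] [MeasurableSpace E'] [MeasurableSingletonClass E']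
  {μ : Measure Ω} [IsFiniteMeasure μ] {FA : E → E → Measure ℝ} {FS : E' → E' → Measure ℝ}
  [∀ i j, IsFiniteMeasure (FA i j)] [∀ i j, IsFiniteMeasure (negKernel FS i j)]
  {JA : ℕ → Ω → E} {JS : ℕ → Ω → E'} {θ : ℝ} {hvA : E → ℝ} {hvS : E' → ℝ}

theorem cond_real_exceedsDuring_neg_le (hA : IsProcess μ FA JA A) (hS : IsProcess μ FS JS S)
    (hindep : IndepFun (fun ω t => (JA t ω, A t ω)) (fun ω t => (JS t ω, S t ω)) μ) (hθ : 0 ≤ θ)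
    (hθAS : θ ∈ expDomain FA ∩ expDomain (negKernel FS)) (hPA : IsPerronVector FA θ hvA)
    (hPS : IsPerronVector (negKernel FS) θ hvS) (d : ℕ) (iA : E) (iS : E') (b : ℝ) {T : ℝ}
    {times : Set ℕ} (htimes : ∀ t ∈ times,
      t * (kappa FA θ + kappa (negKernel FS) θ) ≤ T * (kappa FA θ + kappa (negKernel FS) θ)) :
    (cond μ {ω | JA d ω = iA ∧ JS 0 ω = iS}).real
        (exceedsDuring A (fun t ω => -S t ω) d b times) ≤
      hvA iA * hvS iS / ((⨅ j, hvA j) * ⨅ j, hvS j) * Real.exp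
        (-(θ * b + d * kappa FA θ - T * (kappa FA θ + kappa (negKernel FS) θ))) := by
  have hneg : Measurable fun (path : ℕ → E' × ℝ) t => ((path t).1, -(path t).2) := by
    fun_prop
  exact cond_real_exceedsDuring_le hA hS.neg (hindep.comp measurable_id hneg) hθ hθAS.1 hθAS.2
    hPA hPS d iA iS fun t ht _ => sub_le_sub_left (htimes t ht) _

theorem cond_real_delayExceedsBy_le (hA : IsProcess μ FA JA A) (hS : IsProcess μ FS JS S)
    (hindep : IndepFun (fun ω t => (JA t ω, A t ω)) (fun ω t => (JS t ω, S t ω)) μ) (hθ : 0 ≤ θ)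
    (hθAS : θ ∈ expDomain FA ∩ expDomain (negKernel FS)) (hPA : IsPerronVector FA θ hvA)
    (hPS : IsPerronVector (negKernel FS) θ hvS)
    (hκ : 0 ≤ kappa FA θ + kappa (negKernel FS) θ) (d : ℕ) (iA : E) (iS : E') (T : ℝ) :
    (cond μ {ω | JA d ω = iA ∧ JS 0 ω = iS}).real (delayExceedsBy A S d T) ≤
      delayConst hvA hvS * hvS iS * Real.exp
        (-(d * kappa FA θ - T * (kappa FA θ + kappa (negKernel FS) θ))) := by
  rw [delayExceedsBy_eq_exceedsDuring]
  have hbound := cond_real_exceedsDuring_neg_le hA hS hindep hθ hθAS hPA hPS d iA iS 0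
    (times := {t | (t : ℝ) ≤ T}) fun t ht => mul_le_mul_of_nonneg_right ht hκ
  rw [mul_zero, zero_add] at hbound
  exact hbound.trans (mul_le_mul_of_nonneg_right (div_iInf_mul_iInf_le_delayConst_mul
    (fun i => (hPA.1 i).le) (fun i => (hPS.1 i).le) iA iS) (Real.exp_pos _).le)

theorem cond_real_delayExceeds_sub_le (hA : IsProcess μ FA JA A) (hS : IsProcess μ FS JS S)
    (hindep : IndepFun (fun ω t => (JA t ω, A t ω)) (fun ω t => (JS t ω, S t ω)) μ) (hθ : 0 ≤ θ)
    (hθAS : θ ∈ expDomain FA ∩ expDomain (negKernel FS)) (hPA : IsPerronVector FA θ hvA)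
    (hPS : IsPerronVector (negKernel FS) θ hvS)
    (hκ : kappa FA θ + kappa (negKernel FS) θ ≤ 0) (d : ℕ) (iA : E) (iS : E') (T : ℝ) :
    (cond μ {ω | JA d ω = iA ∧ JS 0 ω = iS}).real (delayExceeds A S d) -
        (cond μ {ω | JA d ω = iA ∧ JS 0 ω = iS}).real (delayExceedsBy A S d T) ≤
      delayConst hvA hvS * hvS iS * Real.exp
        (-(d * kappa FA θ - T * (kappa FA θ + kappa (negKernel FS) θ))) := by
  have hbound := cond_real_exceedsDuring_neg_le hA hS hindep hθ hθAS hPA hPS d iA iS 0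
    (times := {t | T < t}) fun t ht => mul_le_mul_of_nonpos_right (le_of_lt ht) hκ
  rw [mul_zero, zero_add] at hbound
  rw [sub_le_iff_le_add]
  refine ((measureReal_mono (delayExceeds_subset_union A S d T)).trans
    (measureReal_union_le _ _)).trans (add_le_add_left (hbound.trans ?_) _)
  exact mul_le_mul_of_nonneg_right (div_iInf_mul_iInf_le_delayConst_mul
    (fun i => (hPA.1 i).le) (fun i => (hPS.1 i).le) iA iS) (Real.exp_pos _).le

theorem cond_real_backlogExceedsBy_le (hA : IsProcess μ FA JA A) (hS : IsProcess μ FS JS S)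
    (hindep : IndepFun (fun ω t => (JA t ω, A t ω)) (fun ω t => (JS t ω, S t ω)) μ) (hθ : 0 ≤ θ)
    (hθAS : θ ∈ expDomain FA ∩ expDomain (negKernel FS)) (hPA : IsPerronVector FA θ hvA)
    (hPS : IsPerronVector (negKernel FS) θ hvS)
    (hκ : 0 ≤ kappa FA θ + kappa (negKernel FS) θ) (b : ℝ) (iA : E) (iS : E') (T : ℝ) :
    (cond μ {ω | JA 0 ω = iA ∧ JS 0 ω = iS}).real (backlogExceedsBy A S b T) ≤
      backlogConst hvA hvS * hvA iA * hvS iS * Real.exp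
        (-(θ * b - T * (kappa FA θ + kappa (negKernel FS) θ))) := by
  rw [backlogExceedsBy_eq_exceedsDuring, ← div_iInf_mul_iInf_eq_backlogConst_mul]
  simpa using cond_real_exceedsDuring_neg_le hA hS hindep hθ hθAS hPA hPS 0 iA iS b
    (times := {t | (t : ℝ) ≤ T}) fun t ht => mul_le_mul_of_nonneg_right ht hκ

theorem cond_real_backlogExceeds_sub_le (hA : IsProcess μ FA JA A) (hS : IsProcess μ FS JS S)
    (hindep : IndepFun (fun ω t => (JA t ω, A t ω)) (fun ω t => (JS t ω, S t ω)) μ) (hθ : 0 ≤ θ)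
    (hθAS : θ ∈ expDomain FA ∩ expDomain (negKernel FS)) (hPA : IsPerronVector FA θ hvA)
    (hPS : IsPerronVector (negKernel FS) θ hvS)
    (hκ : kappa FA θ + kappa (negKernel FS) θ ≤ 0) (b : ℝ) (iA : E) (iS : E') (T : ℝ) :
    (cond μ {ω | JA 0 ω = iA ∧ JS 0 ω = iS}).real (backlogExceeds A S b) -
        (cond μ {ω | JA 0 ω = iA ∧ JS 0 ω = iS}).real (backlogExceedsBy A S b T) ≤
      backlogConst hvA hvS * hvA iA * hvS iS * Real.exp
        (-(θ * b - T * (kappa FA θ + kappa (negKernel FS) θ))) := by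
  have hbound := cond_real_exceedsDuring_neg_le hA hS hindep hθ hθAS hPA hPS 0 iA iS b
    (times := {t | T < t}) fun t ht => mul_le_mul_of_nonpos_right (le_of_lt ht) hκ
  rw [Nat.cast_zero, zero_mul, add_zero, div_iInf_mul_iInf_eq_backlogConst_mul] at hbound
  rw [sub_le_iff_le_add]
  exact ((measureReal_mono (backlogExceeds_subset_union A S b T)).trans
    (measureReal_union_le _ _)).trans (add_le_add_left hbound _)

end Queue

end MarkovAdditive

theorem mainTheorem4 {Ω E E' : Type*} [MeasurableSpace Ω]
    [Fintype E] [DecidableEq E] [MeasurableSpace E] [MeasurableSingletonClass E]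
    [Fintype E'] [DecidableEq E'] [MeasurableSpace E'] [MeasurableSingletonClass E']
    (μ : Measure Ω) [IsProbabilityMeasure μ]
    -- kernels of the arrival process and of the service process
    (FA : E → E → Measure ℝ) (FS : E' → E' → Measure ℝ)
    (hFA : IsKernel FA) (hFS : IsKernel FS)
    (hirrA : (transitionMatrix FA).IsIrreducible) (hirrS : (transitionMatrix FS).IsIrreducible)
    -- the traffic arriving in a time slot is nonnegative
    (hnonneg : ∀ i j, ∀ᵐ x ∂(FA i j), 0 ≤ x)
    -- the arrival process and the service process, independent of each other
    (JA : ℕ → Ω → E) (A : ℕ → Ω → ℝ) (JS : ℕ → Ω → E') (S : ℕ → Ω → ℝ)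
    (hA : IsProcess μ FA JA A) (hS : IsProcess μ FS JS S)
    (hindep : IndepFun (fun ω t => (JA t ω, A t ω)) (fun ω t => (JS t ω, S t ω)) μ)
    -- the functions `κ^A`, `κ^{-S}` and the positive root `γ` of `κ^A + κ^{-S} = 0`
    (κA κS : ℝ → ℝ) (hκA : κA = kappa FA) (hκS : κS = kappa (negKernel FS))
    (Θ : Set ℝ) (hΘ : Θ = interior (expDomain FA ∩ expDomain (negKernel FS)))
    (γ : ℝ) (hγ : 0 < γ) (hγΘ : γ ∈ Θ) (hγroot : κA γ + κS γ = 0)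
    (hγderiv : 0 < deriv κA γ + deriv κS γ) :
    -- delay
    (∀ y : ℝ, 1 < y → ∀ θ ∈ Θ, y * deriv κS θ = -(y - 1) * deriv κA θ →
      ∀ (hvA : E → ℝ) (hvS : E' → ℝ),
      IsPerronVector FA θ hvA → IsPerronVector (negKernel FS) θ hvS →
      ∀ (d : ℕ) (iA : E) (iS : E'),
      let P := cond μ {ω | JA d ω = iA ∧ JS 0 ω = iS}
      let yγ := deriv κA γ / (deriv κA γ + deriv κS γ)
      let θy := -y * κS θ - (y - 1) * κA θ
      (y < yγ →
        P.real (delayExceedsBy A S d (y * d)) ≤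
          delayConst hvA hvS * hvS iS * Real.exp (-d * θy)) ∧
      (yγ < y →
        P.real (delayExceeds A S d) - P.real (delayExceedsBy A S d (y * d)) ≤
          delayConst hvA hvS * hvS iS * Real.exp (-d * θy))) ∧
    -- backlog
    (∀ y : ℝ, 0 < y → ∀ θ ∈ Θ, y * (deriv κA θ + deriv κS θ) = 1 →
      ∀ (hvA : E → ℝ) (hvS : E' → ℝ),
      IsPerronVector FA θ hvA → IsPerronVector (negKernel FS) θ hvS →
      ∀ (b : ℝ), 0 ≤ b → ∀ (iA : E) (iS : E'),
      let P := cond μ {ω | JA 0 ω = iA ∧ JS 0 ω = iS}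
      let yγ := 1 / (deriv κA γ + deriv κS γ)
      let θy := θ - y * (κA θ + κS θ)
      (y < yγ →
        P.real (backlogExceedsBy A S b (y * b)) ≤
          backlogConst hvA hvS * hvA iA * hvS iS * Real.exp (-b * θy)) ∧
      (yγ < y →
        P.real (backlogExceeds A S b) - P.real (backlogExceedsBy A S b (y * b)) ≤
          backlogConst hvA hvS * hvA iA * hvS iS * Real.exp (-b * θy))) := by
  subst hκA hκS hΘ
  have := hFA.isFiniteMeasure
  have := hFS.negKernel.isFiniteMeasure
  have hirrS' : (transitionMatrix (negKernel FS)).IsIrreducible := by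
    rwa [transitionMatrix_negKernel]
  have hdecay : IsDecayRate FA (negKernel FS) γ := ⟨hγ, hγΘ, hγroot, hγderiv⟩
  constructor
  · intro y hy θ hθ hstat hvA hvS hPA hPS d iA iS P yγ θy
    have : Nonempty E := ⟨iA⟩
    have : Nonempty E' := ⟨iS⟩
    rw [show -d * θy = -(d * kappa FA θ - y * d * (kappa FA θ + kappa (negKernel FS) θ)) by ring]
    refine ⟨fun hlt => ?_, fun hlt => ?_⟩
    · obtain ⟨hθ0, hκ⟩ := hdecay.kappa_add_nonneg_of_delay hirrA hirrS' hθ hy.le hstat hlt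
      exact cond_real_delayExceedsBy_le hA hS hindep hθ0 (interior_subset hθ) hPA hPS hκ d iA iS _
    · obtain ⟨hθ0, hκ⟩ := hdecay.kappa_add_nonpos_of_delay hFA hFS.negKernel hirrA hirrS' hnonneg
        hθ hy.le hstat hlt
      exact cond_real_delayExceeds_sub_le hA hS hindep hθ0 (interior_subset hθ) hPA hPS hκ d iA iS _
  · intro y hy θ hθ hstat hvA hvS hPA hPS b hb iA iS P yγ θy
    have : Nonempty E := ⟨iA⟩
    have : Nonempty E' := ⟨iS⟩
    rw [show -b * θy = -(θ * b - y * b * (kappa FA θ + kappa (negKernel FS) θ)) by ring]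
    refine ⟨fun hlt => ?_, fun hlt => ?_⟩
    · obtain ⟨hθ0, hκ⟩ := hdecay.kappa_add_nonneg_of_backlog hirrA hirrS' hθ hy.le hstat hlt
      exact cond_real_backlogExceedsBy_le hA hS hindep hθ0 (interior_subset hθ) hPA hPS hκ b iA iS _
    · obtain ⟨hθ0, hκ⟩ := hdecay.kappa_add_nonpos_of_backlog hFA hFS.negKernel hirrA hirrS'
        hθ hy hstat hlt
      exact cond_real_backlogExceeds_sub_le hA hS hindep hθ0 (interior_subset hθ) hPA hPS hκ b
        iA iS _
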